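/- Consider the queue $M|GI|\infty$: customers arrive according to a Poisson flow of intensity $\Lambda>0$ at a system with infinitely many servers which is idle at time $0$; each customer is served immediately on arrival; the service times $\xi_1,\xi_2,\dots$ are nonnegative with common law $G$ and not almost surely zero; and all interarrival and service times are mutually independent. A busy period begins whenever a customer arrives at an idle system and lasts until the system is first empty again; let $\stackrel{\circ}{\zeta}_i$ be the length of the $i$-th busy period, $i\ge 1$ (a customer with zero service time who finds the system idle opens a busy period of length zero). Assume that $\mathbb E\,\xi_1^k<\infty$ for some integer $k\ge 1$, and put $\rho=\Lambda\,\mathbb E\,\xi_1>0$. Then, for every $i\ge1$, $$\mathbb E\,(\stackrel{\circ}{\zeta}_i)^k\;\le\;\frac{\mathbb E\,\xi_1^k}{1-e^{-\rho}}\;\varphi\bigl(1-e^{-\rho},\,k-1\bigr),\qquad\text{where}\quad \varphi(x,j)=\sum_{n=1}^\infty n^{j}x^n\quad(|x|<1,\ j\ge 0),$$ and $$\mathbb E\,\stackrel{\circ}{\zeta}_i=\frac{e^{\rho}-1}{\Lambda}.$$ Moreover, for $j\ge1$ and $|x|<1$, $\varphi(x,j)=\left(x\frac{d}{dx}\right)^{j}\frac1{1-x}$.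 -/

import Mathlib

open MeasureTheory ProbabilityTheory

namespace MGInfinity

/-- The function `φ(x, j) = ∑_{n ≥ 1} n ^ j x ^ n` (a convergent series for `|x| < 1`). -/
noncomputable def phi (x : ℝ) (j : ℕ) : ℝ :=
  ∑' n : ℕ, ((n : ℝ) + 1) ^ j * x ^ (n + 1)

/-- The operator `x d/dx`. -/
noncomputable def eulerOp (f : ℝ → ℝ) : ℝ → ℝ := fun x => x * deriv f x

variable {Ω : Type*}

/-- The primitives of the queue `M|GI|∞`, started idle at time `0`. `τ 0` is the time until the first
arrival and `τ (n + 1)` the time between the arrivals of customers `n` and `n + 1`; these are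
exponential with rate `Λ` (Poisson arrivals of intensity `Λ`). `ξ n` is the service time of
customer `n`, a nonnegative random variable with law `G`. All of them are mutually independent. -/
structure IsQueue [MeasurableSpace Ω] (μ : Measure Ω) (Λ : ℝ) (G : Measure ℝ)
    (τ ξ : ℕ → Ω → ℝ) : Prop where
  rate_pos : 0 < Λ
  service_nonneg : G (Set.Iio 0) = 0
  hasLaw_interarrival : ∀ n, HasLaw (τ n) (expMeasure Λ) μ
  hasLaw_service : ∀ n, HasLaw (ξ n) G μ
  indep : iIndepFun (Sum.elim τ ξ) μ

/-- The arrival time of customer `n`; customers are numbered from `0` in order of arrival. -/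
noncomputable def arrival (τ : ℕ → Ω → ℝ) (n : ℕ) (ω : Ω) : ℝ :=
  ∑ j ∈ Finset.range (n + 1), τ j ω

/-- Customer `m` is in service at time `t`: there are infinitely many servers, so the service
starts on arrival and lasts for the time `ξ m`. -/
def InService (τ ξ : ℕ → Ω → ℝ) (ω : Ω) (m : ℕ) (t : ℝ) : Prop :=
  arrival τ m ω ≤ t ∧ t < arrival τ m ω + ξ m ω

/-- The number of customers in the system at time `t`. -/
noncomputable def numCustomers (τ ξ : ℕ → Ω → ℝ) (t : ℝ) (ω : Ω) : ℕ∞ :=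
  {m : ℕ | InService τ ξ ω m t}.encard

/-- Customer `n` arrives at an idle system, i.e. opens a busy period: no earlier customer is in
service at the arrival time of customer `n`. -/
def Opens (τ ξ : ℕ → Ω → ℝ) (ω : Ω) (n : ℕ) : Prop :=
  ∀ m < n, ¬ InService τ ξ ω m (arrival τ n ω)

/-- The customer who opens the `i`-th busy period (busy periods are numbered from `0`). -/
noncomputable def opener (τ ξ : ℕ → Ω → ℝ) (i : ℕ) (ω : Ω) : ℕ :=
  Nat.nth (Opens τ ξ ω) i

/-- The length of the `i`-th busy period: the time from the arrival of the customer who opens it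
until the system is first empty (`∞` if it never is). -/
noncomputable def busyPeriod (τ ξ : ℕ → Ω → ℝ) (i : ℕ) (ω : Ω) : ENNReal :=
  ⨅ t ∈ {t : ℝ | arrival τ (opener τ ξ i ω) ω ≤ t ∧ numCustomers τ ξ t ω = 0},
    ENNReal.ofReal (t - arrival τ (opener τ ξ i ω) ω)

end MGInfinity

/-!
The proof is a renewal argument for the customers of one busy period, counted by the time since the
period began.

Two descriptions of the event that the `i`-th busy period lasts longer than `u` are compared; both
hold on almost every sample path (`IsQueue.ae_regular`).

* *By the last customer to have arrived* (`ofReal_lt_busyPeriod_iff_residual`). The next interarrival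
  time is exponential and independent of the past, so the customers other than the opener arrive at
  the rate `Λ` while the period lasts: the expected number `a` of arrivals (`arrivalMeasure`)
  satisfies `a = δ₀ + Λ ℙ(ζ > u) du` (`IsQueue.lintegral_arrivalMeasure_eq`).
* *By the last arrived among the customers still present* (`ofReal_lt_busyPeriod_iff_last`). If this
  customer arrived at the time `s`, then the service exceeds `u - s` and the queue formed by all later
  customers is empty at its own time `u - s`. Hence `ℙ(ζ > u) = ∫ D(u - s) a(ds)`
  with `D(v) = ℙ(ξ > v) p(v)`, where `p(v)` is the probability that the system is empty at time `v`
  (`IsQueue.busyTail_eq_lintegral`).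

Together they give the renewal equation `a = δ₀ + c ∗ a` with `c(dv) = Λ D(v) dv`
(`IsQueue.arrivalMeasure_eq`). First-step analysis shows `p' = -Λ ℙ(ξ > v) p`, whence
`p(v) = exp (-Λ ∫₀ᵛ ℙ(ξ > w) dw)` (`IsQueue.toReal_idleProb`), and `c`, being `-dp`, has the mass
`1 - exp (-ρ) < 1` (`IsQueue.lastMeasure_univ`). The renewal equation is therefore solved by
`a = ∑ cⁿ`, a sum of convolution powers (`eq_sum_convPow`), and
`Λ ℙ(ζ > u) du = ∑_{n ≥ 1} cⁿ` (`IsQueue.lintegral_pow_busyTail`).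

Total masses yield the mean. For the `k`-th moment, which is `k ∫ u ^ (k - 1) ℙ(ζ > u) du`,
convexity bounds the moments of order `k - 1` of `cⁿ` by `n ^ (k - 1) (1 - exp (-ρ)) ^ (n - 1)` times
that of `c` (`lintegral_pow_convPow_le`), and the latter is at most `Λ 𝔼 ξ ^ k / k` since `p ≤ 1`
(`IsQueue.lintegral_pow_lastMeasure_le`); summation over `n` produces `φ`.

The argument for the `i`-th busy period presupposes that there is one. This follows by induction: a
busy period of finite mean length is almost surely finite and followed by another
(`IsQueue.ae_exists_opensNth`).
-/

namespace MGInfinity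

open Set Filter Topology
open scoped ENNReal Classical

variable {Ω : Type*} {τ ξ : ℕ → Ω → ℝ} {ω : Ω} {i n : ℕ}

/-! ### Sample paths of the queue -/

/-- The sample path of the primitives at `ω` is regular: interarrival times are positive, arrival
times tend to infinity, and no customer arrives exactly when an earlier customer departs. -/
structure Regular (τ ξ : ℕ → Ω → ℝ) (ω : Ω) : Prop where
  pos : ∀ n, 0 < τ n ω
  tendsto : Tendsto (fun n => arrival τ n ω) atTop atTop
  ne : ∀ m n, m < n → arrival τ m ω + ξ m ω ≠ arrival τ n ω

lemma arrival_succ (τ : ℕ → Ω → ℝ) (n : ℕ) (ω : Ω) :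
    arrival τ (n + 1) ω = arrival τ n ω + τ (n + 1) ω := Finset.sum_range_succ _ _

lemma arrival_add (τ : ℕ → Ω → ℝ) (n j : ℕ) (ω : Ω) :
    arrival τ (n + 1 + j) ω = arrival τ n ω + arrival (fun j => τ (n + 1 + j)) j ω := by
  have := Finset.sum_range_add (fun j => τ j ω) (n + 1) (j + 1)
  simpa [arrival, add_assoc] using this

lemma Regular.strictMono (h : Regular τ ξ ω) : StrictMono fun n => arrival τ n ω :=
  strictMono_nat_of_lt_succ fun n => by rw [arrival_succ]; linarith [h.pos (n + 1)]

lemma Regular.exists_between (h : Regular τ ξ ω) {o : ℕ} {t : ℝ} (ho : arrival τ o ω ≤ t) :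
    ∃ N, o ≤ N ∧ arrival τ N ω ≤ t ∧ t < arrival τ (N + 1) ω := by
  have hex : ∃ n, t < arrival τ n ω := (h.tendsto.eventually_gt_atTop t).exists
  have h1 := Nat.find_spec hex
  have h2 : o < Nat.find hex := h.strictMono.lt_iff_lt.1 (ho.trans_lt h1)
  obtain ⟨N, hN⟩ : ∃ N, Nat.find hex = N + 1 := ⟨Nat.find hex - 1, by omega⟩
  refine ⟨N, by omega, ?_, hN ▸ h1⟩
  exact not_lt.1 (Nat.find_min hex (m := N) (by omega))

lemma numCustomers_eq_zero_iff {t : ℝ} :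
    numCustomers τ ξ t ω = 0 ↔ ∀ m, ¬ InService τ ξ ω m t := by
  simp [numCustomers, Set.eq_empty_iff_forall_notMem]

/-- Customer `n` arrives during the `i`-th busy period or opens it (the busy periods being numbered
from `0`): exactly `i + 1` customers among `0, …, n` have arrived at an idle system. -/
def InBusy (τ ξ : ℕ → Ω → ℝ) (i n : ℕ) (ω : Ω) : Prop :=
  Nat.count (Opens τ ξ ω) (n + 1) = i + 1

/-- Customer `n` opens the `i`-th busy period. -/
def OpensNth (τ ξ : ℕ → Ω → ℝ) (i n : ℕ) (ω : Ω) : Prop :=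
  Opens τ ξ ω n ∧ Nat.count (Opens τ ξ ω) n = i

/-- The time from the start of the `i`-th busy period to the arrival of customer `n`, if `n` belongs
to this busy period. -/
noncomputable def elapsed (τ ξ : ℕ → Ω → ℝ) (i n : ℕ) (ω : Ω) : ℝ :=
  ∑ m ∈ Finset.range n, if InBusy τ ξ i m ω then τ (m + 1) ω else 0

/-- The time from the arrival of customer `n` to the last departure among the customers `0, …, n`
(negative if they have all left before). -/
noncomputable def residual (τ ξ : ℕ → Ω → ℝ) (n : ℕ) (ω : Ω) : ℝ :=
  (Finset.range (n + 1)).sup' Finset.nonempty_range_add_one (fun m => arrival τ m ω + ξ m ω)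
    - arrival τ n ω

lemma lt_residual_iff {v : ℝ} :
    v < residual τ ξ n ω ↔ ∃ m ≤ n, arrival τ n ω + v < arrival τ m ω + ξ m ω := by
  rw [residual, lt_sub_iff_add_lt', Finset.lt_sup'_iff]
  simp

lemma not_opens_succ_iff (h : Regular τ ξ ω) :
    ¬ Opens τ ξ ω (n + 1) ↔ τ (n + 1) ω < residual τ ξ n ω := by
  simp only [Opens, lt_residual_iff, InService, not_forall, not_not, arrival_succ, Nat.lt_succ_iff,
    exists_prop]
  refine exists_congr fun m => and_congr_right fun hm => and_iff_right ?_
  linarith [h.strictMono.monotone hm, h.pos (n + 1)]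

lemma OpensNth.opener_eq {o : ℕ} (ho : OpensNth τ ξ i o ω) : opener τ ξ i ω = o := by
  rw [opener, ← ho.2, Nat.nth_count ho.1]

lemma OpensNth.unique {o o' : ℕ} (ho : OpensNth τ ξ i o ω) (ho' : OpensNth τ ξ i o' ω) : o = o' :=
  ho.opener_eq.symm.trans ho'.opener_eq

lemma OpensNth.inBusy {o : ℕ} (ho : OpensNth τ ξ i o ω) : InBusy τ ξ i o ω := by
  rw [InBusy, Nat.count_succ, ho.2, if_pos ho.1]

lemma OpensNth.inBusy_iff {o : ℕ} (ho : OpensNth τ ξ i o ω) :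
    InBusy τ ξ i n ω ↔ o ≤ n ∧ ∀ m, o < m → m ≤ n → ¬ Opens τ ξ ω m := by
  have h1 : Nat.count (Opens τ ξ ω) (o + 1) = i + 1 := ho.inBusy
  constructor
  · intro hn
    have hon : o ≤ n := by
      by_contra! hlt
      have := Nat.count_monotone (Opens τ ξ ω) (show n + 1 ≤ o by omega)
      rw [ho.2, show Nat.count (Opens τ ξ ω) (n + 1) = i + 1 from hn] at this
      omega
    refine ⟨hon, fun m hom hmn hm => ?_⟩
    have h2 := Nat.count_monotone (Opens τ ξ ω) (show o + 1 ≤ m by omega)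
    have h3 := Nat.count_monotone (Opens τ ξ ω) (show m + 1 ≤ n + 1 by omega)
    rw [Nat.count_succ, if_pos hm, show Nat.count (Opens τ ξ ω) (n + 1) = i + 1 from hn] at h3
    omega
  · rintro ⟨hon, hall⟩
    induction n, hon using Nat.le_induction with
    | base => exact h1
    | succ n hn ih =>
      have := ih fun m h1 h2 => hall m h1 (by omega)
      rw [InBusy] at this ⊢
      rw [Nat.count_succ, this, if_neg (hall (n + 1) (by omega) le_rfl)]

lemma inBusy_succ_iff :
    InBusy τ ξ i (n + 1) ω ↔
      OpensNth τ ξ i (n + 1) ω ∨ (InBusy τ ξ i n ω ∧ ¬ Opens τ ξ ω (n + 1)) := by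
  simp only [InBusy, OpensNth]
  rw [Nat.count_succ]
  split_ifs with h <;> simp [h]

lemma opens_zero : Opens τ ξ ω 0 := fun m hm => absurd hm (Nat.not_lt_zero m)

lemma inBusy_zero_iff : InBusy τ ξ i 0 ω ↔ OpensNth τ ξ i 0 ω := by
  simp [InBusy, OpensNth, opens_zero, Nat.count_succ, eq_comm]

lemma InBusy.exists_opensNth (h : InBusy τ ξ i n ω) : ∃ o ≤ n, OpensNth τ ξ i o ω := by
  induction n with
  | zero => exact ⟨0, le_rfl, inBusy_zero_iff.1 h⟩
  | succ n ih =>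
    rcases inBusy_succ_iff.1 h with h | ⟨h, -⟩
    · exact ⟨n + 1, le_rfl, h⟩
    · obtain ⟨o, ho, h⟩ := ih h
      exact ⟨o, by omega, h⟩

lemma OpensNth.elapsed_eq_zero {o : ℕ} (ho : OpensNth τ ξ i o ω) : elapsed τ ξ i o ω = 0 := by
  refine Finset.sum_eq_zero fun m hm => if_neg fun h => ?_
  have := (ho.inBusy_iff.1 h).1
  rw [Finset.mem_range] at hm
  omega

lemma InBusy.elapsed_succ (h : InBusy τ ξ i n ω) :
    elapsed τ ξ i (n + 1) ω = elapsed τ ξ i n ω + τ (n + 1) ω := by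
  rw [elapsed, Finset.sum_range_succ, if_pos h, elapsed]

lemma OpensNth.elapsed_eq {o : ℕ} (ho : OpensNth τ ξ i o ω) (h : InBusy τ ξ i n ω) :
    elapsed τ ξ i n ω = arrival τ n ω - arrival τ o ω := by
  obtain ⟨hon, hall⟩ := ho.inBusy_iff.1 h
  clear h
  induction n, hon using Nat.le_induction with
  | base => rw [ho.elapsed_eq_zero, sub_self]
  | succ n hn ih =>
    have h' : ∀ m, o < m → m ≤ n → ¬ Opens τ ξ ω m := fun m h1 h2 => hall m h1 (by omega)
    rw [(ho.inBusy_iff.2 ⟨hn, h'⟩).elapsed_succ, ih h', arrival_succ]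
    ring

/-- The `i`-th busy period lasts longer than `u` iff the system is busy at all times up to and including
`u` after its opening. The inequality is strict since a customer present at time `u` stays for some
time after `u`, the intervals of service being open on the right. -/
lemma ofReal_lt_busyPeriod_iff_forall {o : ℕ} (ho : OpensNth τ ξ i o ω) {u : ℝ}
    (hu : 0 ≤ u) :
    ENNReal.ofReal u < busyPeriod τ ξ i ω ↔
      ∀ t, arrival τ o ω ≤ t → t ≤ arrival τ o ω + u → ∃ m, InService τ ξ ω m t := by
  rw [busyPeriod, ho.opener_eq]
  constructor
  · intro hlt t ht1 ht2
    by_contra! hne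
    refine absurd hlt (not_lt.2 ?_)
    refine (iInf₂_le t ⟨ht1, numCustomers_eq_zero_iff.2 hne⟩).trans ?_
    exact ENNReal.ofReal_le_ofReal (by linarith)
  · intro hall
    obtain ⟨m, hm1, hm2⟩ := hall _ (le_add_of_nonneg_right hu) le_rfl
    have hlt : u < arrival τ m ω + ξ m ω - arrival τ o ω := by linarith
    refine (ENNReal.ofReal_lt_ofReal_iff (hu.trans_lt hlt)).2 hlt |>.trans_le ?_
    refine le_iInf₂ fun t ⟨ht1, ht2⟩ => ENNReal.ofReal_le_ofReal ?_
    rw [numCustomers_eq_zero_iff] at ht2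
    -- a time `t` at which the system is empty lies after the departure of customer `m`
    have hgt : arrival τ o ω + u < t := by
      by_contra! hle
      obtain ⟨m', hm'⟩ := hall t ht1 hle
      exact ht2 m' hm'
    have : ¬ t < arrival τ m ω + ξ m ω := fun hlt => ht2 m ⟨by linarith, hlt⟩
    linarith

/-- If `N` is the last customer to have arrived by time `T`, the system is busy from the `o`-th arrival
until `T` iff none of the customers after `o` up to `N` has found it idle and it is busy at time `T`.
Regularity enters as follows: if a customer arrived at the very moment the others had left, the system
would have a new opener without ever being empty. -/
lemma forall_inService_iff (h : Regular τ ξ ω) {o N : ℕ} (ho : OpensNth τ ξ i o ω) {T : ℝ}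
    (hoN : o ≤ N) (hN : arrival τ N ω ≤ T) (hN' : T < arrival τ (N + 1) ω) :
    (∀ t, arrival τ o ω ≤ t → t ≤ T → ∃ m, InService τ ξ ω m t) ↔
      InBusy τ ξ i N ω ∧ ∃ m ≤ N, T < arrival τ m ω + ξ m ω := by
  have hmono := h.strictMono
  constructor
  · intro hall
    refine ⟨ho.inBusy_iff.2 ⟨hoN, fun n hon hnN hn => ?_⟩, ?_⟩
    · -- Every earlier customer has left strictly before customer `n` arrives, so the system is
      -- empty just before this arrival.
      obtain ⟨k, rfl⟩ : ∃ k, n = k + 1 := ⟨n - 1, by omega⟩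
      have hres : residual τ ξ k ω < τ (k + 1) ω := by
        refine lt_of_le_of_ne (not_lt.1 fun hlt => (not_opens_succ_iff h).2 hlt hn) fun heq => ?_
        obtain ⟨m, hm, hm'⟩ := Finset.exists_mem_eq_sup' (Finset.nonempty_range_add_one (n := k))
          (fun m => arrival τ m ω + ξ m ω)
        refine h.ne m (k + 1) (Finset.mem_range.1 hm) ?_
        rw [residual, hm'] at heq
        rw [arrival_succ]
        linarith
      obtain ⟨v, hv1, hv2⟩ := exists_between (max_lt hres (h.pos (k + 1)))
      have hv3 := (le_max_left _ _).trans_lt hv1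
      have hv4 := (le_max_right _ _).trans_lt hv1
      have hok : arrival τ o ω ≤ arrival τ k ω := hmono.monotone (by omega)
      have hkN : arrival τ (k + 1) ω ≤ arrival τ N ω := hmono.monotone (by omega)
      rw [arrival_succ] at hkN
      obtain ⟨m, hm1, hm2⟩ := hall (arrival τ k ω + v) (by linarith) (by linarith)
      have hmk : m ≤ k := by
        have : arrival τ m ω < arrival τ (k + 1) ω := by rw [arrival_succ]; linarith
        have := hmono.lt_iff_lt.1 this
        omega
      exact absurd (lt_residual_iff.2 ⟨m, hmk, hm2⟩) (not_lt.2 hv3.le)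
    · obtain ⟨m, hm1, hm2⟩ := hall T ((hmono.monotone hoN).trans hN) le_rfl
      have := hmono.lt_iff_lt.1 (hm1.trans_lt hN')
      exact ⟨m, by omega, hm2⟩
  · rintro ⟨hB, m, hmN, hm⟩ t ht1 ht2
    obtain ⟨n, hon, hn1, hn2⟩ := h.exists_between ht1
    have hnN : n ≤ N := by
      have := hmono.lt_iff_lt.1 ((hn1.trans ht2).trans_lt hN')
      omega
    rcases hnN.eq_or_lt with rfl | hlt
    · exact ⟨m, (hmono.monotone hmN).trans hn1, by linarith⟩
    · have := (ho.inBusy_iff.1 hB).2 (n + 1) (by omega) (by omega)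
      rw [not_opens_succ_iff h, lt_residual_iff, ← arrival_succ] at this
      obtain ⟨m', hm', hlt'⟩ := this
      exact ⟨m', (hmono.monotone hm').trans hn1, by linarith⟩

/-- The `i`-th busy period lasts longer than `u` iff the last customer to have arrived by then belongs
to it and some customer is still present. -/
lemma ofReal_lt_busyPeriod_iff_residual (h : Regular τ ξ ω) (hex : ∃ o, OpensNth τ ξ i o ω) {u : ℝ}
    (hu : 0 ≤ u) :
    ENNReal.ofReal u < busyPeriod τ ξ i ω ↔
      ∃ n, InBusy τ ξ i n ω ∧ elapsed τ ξ i n ω ≤ u ∧ u - elapsed τ ξ i n ω < τ (n + 1) ω ∧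
        u - elapsed τ ξ i n ω < residual τ ξ n ω := by
  obtain ⟨o, ho⟩ := hex
  rw [ofReal_lt_busyPeriod_iff_forall ho hu]
  constructor
  · intro hall
    obtain ⟨N, hoN, hN, hN'⟩ := h.exists_between (o := o) (le_add_of_nonneg_right hu)
    obtain ⟨hB, hm⟩ := (forall_inService_iff h ho hoN hN hN').1 hall
    refine ⟨N, hB, ?_⟩
    rw [lt_residual_iff, ho.elapsed_eq hB]
    rw [arrival_succ] at hN'
    refine ⟨by linarith, by linarith, ?_⟩
    obtain ⟨m, hm, hlt⟩ := hm
    exact ⟨m, hm, by linarith⟩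
  · rintro ⟨n, hB, h1, h2, h3⟩
    rw [lt_residual_iff] at h3
    rw [ho.elapsed_eq hB] at h1 h2 h3
    refine (forall_inService_iff h ho (N := n) (ho.inBusy_iff.1 hB).1 (by linarith)
      (by rw [arrival_succ]; linarith)).2 ⟨hB, ?_⟩
    obtain ⟨m, hm, hlt⟩ := h3
    exact ⟨m, hm, by linarith⟩

lemma inService_add_iff {o j : ℕ} {u : ℝ} (ho : OpensNth τ ξ i o ω)
    (hB : InBusy τ ξ i n ω) :
    InService (fun j => τ (n + 1 + j)) (fun j => ξ (n + 1 + j)) ω j (u - elapsed τ ξ i n ω) ↔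
      InService τ ξ ω (n + 1 + j) (arrival τ o ω + u) := by
  rw [InService, InService, arrival_add, ho.elapsed_eq hB]
  constructor <;> rintro ⟨h1, h2⟩ <;> constructor <;> linarith

/-- The `i`-th busy period lasts longer than `u` iff some customer of it is still present by then while
all later ones are gone or have not yet arrived. -/
lemma ofReal_lt_busyPeriod_iff_last (h : Regular τ ξ ω) (hex : ∃ o, OpensNth τ ξ i o ω) {u : ℝ}
    (hu : 0 ≤ u) :
    ENNReal.ofReal u < busyPeriod τ ξ i ω ↔
      ∃ n, InBusy τ ξ i n ω ∧ elapsed τ ξ i n ω ≤ u ∧ u - elapsed τ ξ i n ω < ξ n ω ∧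
        ∀ j, ¬ InService (fun j => τ (n + 1 + j)) (fun j => ξ (n + 1 + j)) ω j
          (u - elapsed τ ξ i n ω) := by
  obtain ⟨o, ho⟩ := hex
  have hmono := h.strictMono
  rw [ofReal_lt_busyPeriod_iff_forall ho hu]
  obtain ⟨N, hoN, hN, hN'⟩ := h.exists_between (o := o) (le_add_of_nonneg_right hu)
  rw [forall_inService_iff h ho hoN hN hN']
  constructor
  · rintro ⟨hB, m, hm, hlt⟩
    set P : ℕ → Prop := fun m => arrival τ o ω + u < arrival τ m ω + ξ m ω with hP
    have hPl : P (Nat.findGreatest P N) := Nat.findGreatest_spec hm hlt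
    have hle : Nat.findGreatest P N ≤ N := Nat.findGreatest_le N
    set l := Nat.findGreatest P N with hl
    -- the customers before the opener have left by the time of the opening
    have hol : o ≤ l := by
      by_contra! hlo
      refine ho.1 l hlo ⟨hmono.monotone hlo.le, ?_⟩
      rw [hP] at hPl
      linarith
    have hBl : InBusy τ ξ i l ω := ho.inBusy_iff.2
      ⟨hol, fun m h1 h2 => (ho.inBusy_iff.1 hB).2 m h1 (h2.trans hle)⟩
    have hAl : arrival τ l ω ≤ arrival τ N ω := hmono.monotone hle
    refine ⟨l, hBl, ?_, ?_, fun j => ?_⟩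
    · rw [ho.elapsed_eq hBl]; linarith
    · rw [ho.elapsed_eq hBl]
      rw [hP] at hPl
      linarith
    · rw [inService_add_iff ho hBl]
      rintro ⟨h1, h2⟩
      have h3 := hmono.lt_iff_lt.1 (h1.trans_lt hN')
      exact Nat.findGreatest_is_greatest (P := P) (n := N) (k := l + 1 + j) (by omega) (by omega) h2
  · rintro ⟨n, hB, h1, h2, h3⟩
    simp only [inService_add_iff ho hB] at h3
    rw [ho.elapsed_eq hB] at h1 h2
    have hnN : n ≤ N := by
      have : arrival τ n ω < arrival τ (N + 1) ω := by linarith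
      have := hmono.lt_iff_lt.1 this
      omega
    refine ⟨ho.inBusy_iff.2 ⟨hoN, fun m hom hmN hm => ?_⟩, n, hnN, by linarith⟩
    rcases le_or_gt m n with hmn | hmn
    · exact (ho.inBusy_iff.1 hB).2 m hom hmn hm
    · refine hm n hmn ⟨hmono.monotone hmn.le, ?_⟩
      have : arrival τ m ω ≤ arrival τ N ω := hmono.monotone hmN
      linarith

lemma eq_of_residual (h : Regular τ ξ ω) {u : ℝ} {n n' : ℕ} (hB : InBusy τ ξ i n ω)
    (h1 : elapsed τ ξ i n ω ≤ u) (h2 : u - elapsed τ ξ i n ω < τ (n + 1) ω)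
    (hB' : InBusy τ ξ i n' ω) (h1' : elapsed τ ξ i n' ω ≤ u)
    (h2' : u - elapsed τ ξ i n' ω < τ (n' + 1) ω) : n = n' := by
  obtain ⟨o, -, ho⟩ := hB.exists_opensNth
  rw [ho.elapsed_eq hB] at h1 h2
  rw [ho.elapsed_eq hB'] at h1' h2'
  have h3 : arrival τ n ω < arrival τ (n' + 1) ω := by rw [arrival_succ]; linarith
  have h4 : arrival τ n' ω < arrival τ (n + 1) ω := by rw [arrival_succ]; linarith
  have h5 := h.strictMono.lt_iff_lt.1 h3
  have h6 := h.strictMono.lt_iff_lt.1 h4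
  omega

lemma le_of_last {u : ℝ} {n n' : ℕ} (hB : InBusy τ ξ i n ω)
    (h3 : ∀ j, ¬ InService (fun j => τ (n + 1 + j)) (fun j => ξ (n + 1 + j)) ω j
      (u - elapsed τ ξ i n ω))
    (hB' : InBusy τ ξ i n' ω) (h1' : elapsed τ ξ i n' ω ≤ u)
    (h2' : u - elapsed τ ξ i n' ω < ξ n' ω) : n' ≤ n := by
  by_contra! hlt
  obtain ⟨j, rfl⟩ : ∃ j, n' = n + 1 + j := ⟨n' - (n + 1), by omega⟩
  obtain ⟨o, -, ho⟩ := hB.exists_opensNth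
  refine h3 j ((inService_add_iff ho hB).2 ?_)
  rw [ho.elapsed_eq hB'] at h1' h2'
  constructor <;> linarith

/-- After a busy period of finite length there is another one. -/
lemma exists_opensNth_succ (h : Regular τ ξ ω) (hex : ∃ o, OpensNth τ ξ i o ω)
    (hfin : busyPeriod τ ξ i ω ≠ ∞) : ∃ o, OpensNth τ ξ (i + 1) o ω := by
  obtain ⟨o, ho⟩ := hex
  have hnot : ¬ ENNReal.ofReal (busyPeriod τ ξ i ω).toReal < busyPeriod τ ξ i ω := by
    rw [ENNReal.ofReal_toReal hfin]; exact lt_irrefl _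
  rw [ofReal_lt_busyPeriod_iff_forall ho ENNReal.toReal_nonneg] at hnot
  push Not at hnot
  obtain ⟨t, ht1, -, ht3⟩ := hnot
  obtain ⟨N, hoN, hN, hN'⟩ := h.exists_between ht1
  have hopen : Opens τ ξ ω (N + 1) := fun m hm hs => by
    refine ht3 m ⟨(h.strictMono.monotone (Nat.lt_succ_iff.1 hm)).trans hN, ?_⟩
    exact hN'.trans hs.2
  -- the first opener after `o`
  have hex : ∃ n, o < n ∧ Opens τ ξ ω n := ⟨N + 1, by omega, hopen⟩
  obtain ⟨hlt, hop⟩ := Nat.find_spec hex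
  obtain ⟨k, hk⟩ : ∃ k, Nat.find hex = k + 1 := ⟨Nat.find hex - 1, by omega⟩
  rw [hk] at hop hlt
  refine ⟨k + 1, hop, ?_⟩
  refine ho.inBusy_iff.2 ⟨by omega, fun m h1 h2 h3 => ?_⟩
  exact Nat.find_min hex (m := m) (by omega) ⟨h1, h3⟩

/-! ### Measurability and independence -/

section Measurability

variable [MeasurableSpace Ω]

lemma measurable_arrival (hτ : ∀ j ≤ n, Measurable (τ j)) : Measurable (arrival τ n) :=
  Finset.measurable_fun_sum _ fun j hj => hτ j (Nat.lt_succ_iff.1 (Finset.mem_range.1 hj))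

lemma measurableSet_inService {m : ℕ} (hτ : ∀ j ≤ m, Measurable (τ j)) (hξ : Measurable (ξ m))
    {t : Ω → ℝ} (ht : Measurable t) : MeasurableSet {ω | InService τ ξ ω m (t ω)} :=
  (measurableSet_le (measurable_arrival hτ) ht).inter
    (measurableSet_lt ht ((measurable_arrival hτ).add hξ))

lemma measurableSet_opens (hτ : ∀ j ≤ n, Measurable (τ j)) (hξ : ∀ j < n, Measurable (ξ j)) :
    MeasurableSet {ω | Opens τ ξ ω n} := by
  simp only [Opens, ofPred_forall]
  exact MeasurableSet.iInter fun m => MeasurableSet.iInter fun hm =>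
    (measurableSet_inService (fun j hj => hτ j (by omega)) (hξ m hm) (measurable_arrival hτ)).compl

lemma measurable_count_opens (hτ : ∀ j < n, Measurable (τ j)) (hξ : ∀ j < n, Measurable (ξ j)) :
    Measurable fun ω => Nat.count (Opens τ ξ ω) n := by
  induction n with
  | zero => simp
  | succ n ih =>
    simp only [Nat.count_succ]
    refine (ih (fun j hj => hτ j (by omega)) fun j hj => hξ j (by omega)).add ?_
    exact Measurable.ite (measurableSet_opens (fun j hj => hτ j (by omega))
      fun j hj => hξ j (by omega)) measurable_const measurable_const

lemma measurableSet_opensNth (hτ : ∀ j ≤ n, Measurable (τ j)) (hξ : ∀ j < n, Measurable (ξ j)) :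
    MeasurableSet {ω | OpensNth τ ξ i n ω} :=
  (measurableSet_opens hτ hξ).inter
    (measurable_count_opens (fun j hj => hτ j hj.le) hξ (measurableSet_singleton i))

lemma measurableSet_inBusy (hτ : ∀ j ≤ n, Measurable (τ j)) (hξ : ∀ j < n, Measurable (ξ j)) :
    MeasurableSet {ω | InBusy τ ξ i n ω} := by
  have : Measurable fun ω => Nat.count (Opens τ ξ ω) (n + 1) := by
    simp only [Nat.count_succ]
    exact (measurable_count_opens (fun j hj => hτ j hj.le) hξ).add
      (Measurable.ite (measurableSet_opens hτ hξ) measurable_const measurable_const)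
  exact this (measurableSet_singleton (i + 1))

lemma measurable_elapsed (hτ : ∀ j ≤ n, Measurable (τ j)) (hξ : ∀ j < n, Measurable (ξ j)) :
    Measurable (elapsed τ ξ i n) := by
  refine Finset.measurable_fun_sum _ fun m hm => ?_
  rw [Finset.mem_range] at hm
  exact Measurable.ite (measurableSet_inBusy (fun j hj => hτ j (by omega))
    fun j hj => hξ j (by omega)) (hτ _ hm) measurable_const

lemma measurable_residual (hτ : ∀ j ≤ n, Measurable (τ j)) (hξ : ∀ j ≤ n, Measurable (ξ j)) :
    Measurable (residual τ ξ n) := by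
  refine Measurable.sub ?_ (measurable_arrival hτ)
  have := Finset.measurable_sup' (Finset.nonempty_range_add_one (n := n))
    (f := fun m ω => arrival τ m ω + ξ m ω) fun m hm => by
      have hm' := Finset.mem_range.1 hm
      exact (measurable_arrival fun j hj => hτ j (by omega)).add (hξ m (by omega))
  convert this using 1
  ext ω
  simp [Finset.sup'_apply]

end Measurability

/-- The σ-algebra generated by the interarrival and service times with indices in `S`; `Sum.inl j`
stands for `τ j` and `Sum.inr j` for `ξ j`. -/
@[reducible] def sigmaOf (τ ξ : ℕ → Ω → ℝ) (S : Set (ℕ ⊕ ℕ)) : MeasurableSpace Ω :=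
  ⨆ k ∈ S, MeasurableSpace.comap (Sum.elim τ ξ k) inferInstance

lemma measurable_sigmaOf_interarrival {S : Set (ℕ ⊕ ℕ)} {j : ℕ} (hj : Sum.inl j ∈ S) :
    Measurable[sigmaOf τ ξ S] (τ j) :=
  measurable_iff_comap_le.2 <|
    le_iSup₂_of_le (f := fun k (_ : k ∈ S) => MeasurableSpace.comap (Sum.elim τ ξ k) inferInstance)
      (Sum.inl j) hj le_rfl

lemma measurable_sigmaOf_service {S : Set (ℕ ⊕ ℕ)} {j : ℕ} (hj : Sum.inr j ∈ S) :
    Measurable[sigmaOf τ ξ S] (ξ j) :=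
  measurable_iff_comap_le.2 <|
    le_iSup₂_of_le (f := fun k (_ : k ∈ S) => MeasurableSpace.comap (Sum.elim τ ξ k) inferInstance)
      (Sum.inr j) hj le_rfl

/-- The interarrival and service times of the customers from number `n` on. -/
def future (τ ξ : ℕ → Ω → ℝ) (n : ℕ) (ω : Ω) : ℕ ⊕ ℕ → ℝ :=
  Sum.elim (fun j => τ (n + j) ω) (fun j => ξ (n + j) ω)

/-- The queue with interarrival and service times `w` is empty at time `v`. -/
def IdleAt (v : ℝ) (w : ℕ ⊕ ℕ → ℝ) : Prop :=
  ∀ j, ¬ InService (fun j w => w (Sum.inl j)) (fun j w => w (Sum.inr j)) w j v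

lemma idleAt_future_iff {v : ℝ} :
    IdleAt v (future τ ξ n ω) ↔
      ∀ j, ¬ InService (fun j => τ (n + j)) (fun j => ξ (n + j)) ω j v := Iff.rfl

lemma measurableSet_idleAt : MeasurableSet {p : ℝ × (ℕ ⊕ ℕ → ℝ) | IdleAt p.1 p.2} := by
  simp only [IdleAt, ofPred_forall]
  refine MeasurableSet.iInter fun j => MeasurableSet.compl ?_
  exact measurableSet_inService
    (τ := fun j (p : ℝ × (ℕ ⊕ ℕ → ℝ)) => p.2 (Sum.inl j)) (ξ := fun j p => p.2 (Sum.inr j))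
    (fun j _ => by fun_prop) (by fun_prop) measurable_fst

lemma measurableSet_idleAt_left (u : ℝ) : MeasurableSet {w | IdleAt u w} :=
  measurable_prodMk_left (x := u) measurableSet_idleAt

lemma lintegral_ite_one [MeasurableSpace Ω] {μ : Measure Ω} {p : Ω → Prop} [DecidablePred p]
    (hp : MeasurableSet {ω | p ω}) : ∫⁻ ω, (if p ω then 1 else 0) ∂μ = μ {ω | p ω} := by
  rw [← lintegral_indicator_one hp]
  exact lintegral_congr fun ω => by simp [indicator]

lemma measurable_future [MeasurableSpace Ω] (hτ : ∀ j, n ≤ j → Measurable (τ j))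
    (hξ : ∀ j, n ≤ j → Measurable (ξ j)) : Measurable (future τ ξ n) := by
  refine measurable_pi_iff.2 fun k => ?_
  cases k with
  | inl j => exact hτ _ (by omega)
  | inr j => exact hξ _ (by omega)

lemma lintegral_comp_of_indepFun [MeasurableSpace Ω] {μ : Measure Ω} [IsProbabilityMeasure μ]
    {α β : Type*} [MeasurableSpace α] [MeasurableSpace β] {Y : Ω → α} {W : Ω → β}
    (h : IndepFun Y W μ) (hY : Measurable Y) (hW : Measurable W) {Φ : α × β → ℝ≥0∞}
    (hΦ : Measurable Φ) :
    ∫⁻ ω, Φ (Y ω, W ω) ∂μ = ∫⁻ ω, ∫⁻ ω', Φ (Y ω, W ω') ∂μ ∂μ := by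
  have hmap := (indepFun_iff_map_prod_eq_prod_map_map hY.aemeasurable hW.aemeasurable).1 h
  rw [← lintegral_map (f := Φ) hΦ (hY.prodMk hW), hmap, lintegral_prod _ hΦ.aemeasurable,
    lintegral_map hΦ.lintegral_prod_right' hY]
  refine lintegral_congr fun ω => ?_
  exact lintegral_map (hΦ.comp measurable_prodMk_left) hW

lemma measure_setOf_of_indepFun [MeasurableSpace Ω] {μ : Measure Ω} [IsProbabilityMeasure μ]
    {α β : Type*} [MeasurableSpace α] [MeasurableSpace β] {Y : Ω → α} {W : Ω → β}
    (h : IndepFun Y W μ) (hY : Measurable Y) (hW : Measurable W) {A : Set (α × β)}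
    (hA : MeasurableSet A) :
    μ {ω | (Y ω, W ω) ∈ A} = ∫⁻ ω, μ {ω' | (Y ω, W ω') ∈ A} ∂μ := by
  have h1 : MeasurableSet {ω | (Y ω, W ω) ∈ A} := (hY.prodMk hW) hA
  have h2 : ∀ ω, MeasurableSet {ω' | (Y ω, W ω') ∈ A} := fun ω => (measurable_const.prodMk hW) hA
  rw [← lintegral_ite_one h1, lintegral_comp_of_indepFun h hY hW (Φ := fun p => if p ∈ A then 1 else 0)
    (Measurable.ite hA measurable_const measurable_const)]
  exact lintegral_congr fun ω => lintegral_ite_one (h2 ω)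

section Queue

variable [MeasurableSpace Ω] {μ : Measure Ω} {Λ : ℝ} {G : Measure ℝ}

lemma IsQueue.indepFun_of_disjoint (hQ : IsQueue μ Λ G τ ξ) (hτ : ∀ n, Measurable (τ n))
    (hξ : ∀ n, Measurable (ξ n)) {α β : Type*} [MeasurableSpace α] [MeasurableSpace β]
    {Y : Ω → α} {W : Ω → β} (S T : Set (ℕ ⊕ ℕ)) (hST : Disjoint S T)
    (hY : Measurable[sigmaOf τ ξ S] Y) (hW : Measurable[sigmaOf τ ξ T] W) : IndepFun Y W μ := by
  rw [IndepFun_iff_Indep]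
  have h := indep_iSup_of_disjoint
    (m := fun k => MeasurableSpace.comap (Sum.elim τ ξ k) inferInstance) (fun k => by
      cases k with
      | inl j => exact (hτ j).comap_le
      | inr j => exact (hξ j).comap_le) hQ.indep hST
  exact indep_of_indep_of_le_left (indep_of_indep_of_le_right h hW.comap_le) hY.comap_le

/-- The law of the primitives does not depend on the customer from whom they are counted. -/
lemma IsQueue.map_future [IsProbabilityMeasure μ] (hQ : IsQueue μ Λ G τ ξ)
    (hτ : ∀ n, Measurable (τ n)) (hξ : ∀ n, Measurable (ξ n)) (n : ℕ) :
    μ.map (future τ ξ n) = μ.map (future τ ξ 0) := by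
  have hm : ∀ k, Measurable (Sum.elim τ ξ k) := fun k => by
    cases k with
    | inl j => exact hτ j
    | inr j => exact hξ j
  have key : ∀ n, μ.map (future τ ξ n) =
      Measure.infinitePi fun k => μ.map (Sum.elim τ ξ (Sum.map (n + ·) (n + ·) k)) := fun n => by
    have hinj : Function.Injective (Sum.map (n + ·) (n + ·) : ℕ ⊕ ℕ → ℕ ⊕ ℕ) :=
      Function.Injective.sumMap (add_right_injective n) (add_right_injective n)
    rw [← (hQ.indep.precomp hinj).map_fun_eq_infinitePi_map (fun k => hm _)]
    congr 1
    ext ω k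
    cases k <;> rfl
  rw [key, key]
  congr 1
  ext1 k
  cases k with
  | inl j => exact (hQ.hasLaw_interarrival _).map_eq.trans (hQ.hasLaw_interarrival _).map_eq.symm
  | inr j => exact (hQ.hasLaw_service _).map_eq.trans (hQ.hasLaw_service _).map_eq.symm

end Queue

/-! ### The exponential law -/

section Exponential

variable {Λ : ℝ}

lemma expMeasure_Ioi (hΛ : 0 < Λ) {v : ℝ} (hv : 0 ≤ v) :
    expMeasure Λ (Ioi v) = ENNReal.ofReal (Real.exp (-(Λ * v))) := by
  have := isProbabilityMeasure_expMeasure hΛ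
  have h1 : 0 ≤ 1 - Real.exp (-(Λ * v)) := by
    have := Real.exp_le_one_iff.2 (show -(Λ * v) ≤ 0 by nlinarith)
    linarith
  rw [← compl_Iic, prob_compl_eq_one_sub measurableSet_Iic, ← ofReal_cdf, cdf_expMeasure_eq hΛ,
    if_pos hv, ← ENNReal.ofReal_one, ← ENNReal.ofReal_sub _ h1]
  congr 1
  ring

lemma expMeasure_Iic_zero (hΛ : 0 < Λ) : expMeasure Λ (Iic 0) = 0 := by
  have := isProbabilityMeasure_expMeasure hΛ
  rw [← ofReal_cdf, cdf_expMeasure_eq hΛ]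
  simp

lemma expMeasure_eq_withDensity : expMeasure Λ = volume.withDensity (exponentialPDF Λ) := rfl

lemma expMeasure_singleton (x : ℝ) : expMeasure Λ {x} = 0 :=
  withDensity_absolutelyContinuous volume (exponentialPDF Λ) (by simp)

/-- The exponential law is `Λ` times its own tail, as a density on `[0, ∞)`. -/
lemma lintegral_expMeasure (hΛ : 0 < Λ) {φ : ℝ → ℝ≥0∞} (hφ : Measurable φ) :
    ∫⁻ s, φ s ∂expMeasure Λ =
      ENNReal.ofReal Λ * ∫⁻ v in Ici 0, φ v * expMeasure Λ (Ioi v) := by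
  have hm : Measurable (exponentialPDF Λ) := (measurable_exponentialPDFReal Λ).ennreal_ofReal
  have hm2 : Measurable fun v => φ v * expMeasure Λ (Ioi v) := by
    refine hφ.mul (Antitone.measurable fun x y hxy => measure_mono (Ioi_subset_Ioi hxy))
  rw [expMeasure_eq_withDensity, lintegral_withDensity_eq_lintegral_mul _ hm hφ,
    ← expMeasure_eq_withDensity, ← lintegral_const_mul _ hm2, ← lintegral_indicator measurableSet_Ici]
  refine lintegral_congr fun v => ?_
  by_cases hv : 0 ≤ v
  · rw [indicator_of_mem (show v ∈ Ici (0 : ℝ) from hv), Pi.mul_apply,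
      exponentialPDF_of_nonneg hv, expMeasure_Ioi hΛ hv, ENNReal.ofReal_mul hΛ.le]
    ring
  · rw [indicator_of_notMem (show v ∉ Ici (0 : ℝ) from hv), Pi.mul_apply,
      exponentialPDF_of_neg (not_le.1 hv), zero_mul]

end Exponential

/-! ### Almost all sample paths are regular -/

section Regularity

variable [MeasurableSpace Ω] {μ : Measure Ω} {Λ : ℝ} {G : Measure ℝ}

lemma IsQueue.measure_interarrival (hQ : IsQueue μ Λ G τ ξ) (n : ℕ) {s : Set ℝ}
    (hs : MeasurableSet s) : μ {ω | τ n ω ∈ s} = expMeasure Λ s := by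
  rw [← (hQ.hasLaw_interarrival n).map_eq,
    Measure.map_apply_of_aemeasurable (hQ.hasLaw_interarrival n).aemeasurable hs]
  rfl

lemma IsQueue.measure_service (hQ : IsQueue μ Λ G τ ξ) (n : ℕ) {s : Set ℝ}
    (hs : MeasurableSet s) : μ {ω | ξ n ω ∈ s} = G s := by
  rw [← (hQ.hasLaw_service n).map_eq,
    Measure.map_apply_of_aemeasurable (hQ.hasLaw_service n).aemeasurable hs]
  rfl

lemma IsQueue.ae_pos (hQ : IsQueue μ Λ G τ ξ) : ∀ᵐ ω ∂μ, ∀ n, 0 < τ n ω := by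
  refine ae_all_iff.2 fun n => ?_
  have := hQ.measure_interarrival n (s := Iic 0) measurableSet_Iic
  rw [expMeasure_Iic_zero hQ.rate_pos] at this
  rw [ae_iff]
  simpa using this

/-- By the second Borel–Cantelli lemma infinitely many interarrival times exceed `1`. -/
lemma IsQueue.ae_frequently [IsProbabilityMeasure μ] (hQ : IsQueue μ Λ G τ ξ) (hτ : ∀ n, Measurable (τ n)) :
    ∀ᵐ ω ∂μ, ∃ᶠ n in atTop, 1 < τ n ω := by
  have hm : ∀ n, MeasurableSet {ω | 1 < τ n ω} := fun n => hτ n measurableSet_Ioi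
  have hind : iIndepFun τ μ := hQ.indep.precomp (g := Sum.inl) Sum.inl_injective
  have hset : iIndepSet (fun n => {ω | 1 < τ n ω}) μ := by
    rw [iIndepSet_iff_meas_biInter hm]
    intro S
    exact (iIndepFun_iff_measure_inter_preimage_eq_mul.1 hind) S (sets := fun _ => Ioi 1)
      fun _ _ => measurableSet_Ioi
  have hsum : ∑' n, μ {ω | 1 < τ n ω} = ∞ := by
    have : ∀ n, μ {ω | 1 < τ n ω} = ENNReal.ofReal (Real.exp (-(Λ * 1))) := fun n =>
      (hQ.measure_interarrival n measurableSet_Ioi).trans (expMeasure_Ioi hQ.rate_pos zero_le_one)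
    simp only [this]
    exact ENNReal.tsum_const_eq_top_of_ne_zero (by simpa using Real.exp_pos _)
  have h1 := measure_limsup_eq_one hm hset hsum
  have h2 : ∀ᵐ ω ∂μ, ω ∈ limsup (fun n => {ω | 1 < τ n ω}) atTop :=
    (mem_ae_iff_prob_eq_one (MeasurableSet.measurableSet_limsup hm)).2 h1
  filter_upwards [h2] with ω hω
  exact mem_limsup_iff_frequently_mem.1 hω

/-- The law of the last interarrival time before customer `n` has no atoms. -/
lemma IsQueue.ae_ne [IsProbabilityMeasure μ] (hQ : IsQueue μ Λ G τ ξ) (hτ : ∀ n, Measurable (τ n))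
    (hξ : ∀ n, Measurable (ξ n)) (m n : ℕ) (hmn : m < n) :
    ∀ᵐ ω ∂μ, arrival τ m ω + ξ m ω ≠ arrival τ n ω := by
  obtain ⟨k, rfl⟩ : ∃ k, n = k + 1 := ⟨n - 1, by omega⟩
  let Y : Ω → ℝ := fun ω => arrival τ m ω + ξ m ω - arrival τ k ω
  have hY : Measurable[sigmaOf τ ξ {Sum.inl (k + 1)}ᶜ] Y := by
    refine @Measurable.sub _ _ _ _ _ (_) _ _ (@Measurable.add _ _ _ _ _ (_) _ _
      (@measurable_arrival _ _ _ (_) fun j hj => measurable_sigmaOf_interarrival ?_)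
      (measurable_sigmaOf_service ?_))
      (@measurable_arrival _ _ _ (_) fun j hj => measurable_sigmaOf_interarrival ?_) <;>
    simp <;> omega
  have hind : IndepFun Y (τ (k + 1)) μ := hQ.indepFun_of_disjoint hτ hξ {Sum.inl (k + 1)}ᶜ
    {Sum.inl (k + 1)} disjoint_compl_left hY (measurable_sigmaOf_interarrival rfl)
  have hYm : Measurable Y := ((measurable_arrival fun j _ => hτ j).add (hξ m)).sub
    (measurable_arrival fun j _ => hτ j)
  have hD : MeasurableSet {p : ℝ × ℝ | p.2 = p.1} := measurableSet_eq_fun measurable_snd measurable_fst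
  have key := lintegral_comp_of_indepFun hind hYm (hτ (k + 1))
    (Φ := {p : ℝ × ℝ | p.2 = p.1}.indicator 1) (measurable_one.indicator hD)
  have hzero : ∀ ω, ∫⁻ ω', {p : ℝ × ℝ | p.2 = p.1}.indicator (1 : ℝ × ℝ → ℝ≥0∞)
      (Y ω, τ (k + 1) ω') ∂μ = 0 := fun ω => by
    have : (fun ω' => {p : ℝ × ℝ | p.2 = p.1}.indicator (1 : ℝ × ℝ → ℝ≥0∞) (Y ω, τ (k + 1) ω')) =
        {ω' | τ (k + 1) ω' ∈ ({Y ω} : Set ℝ)}.indicator 1 := by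
      ext ω'; simp [indicator]
    have hms : MeasurableSet {ω' | τ (k + 1) ω' ∈ ({Y ω} : Set ℝ)} :=
      hτ (k + 1) (measurableSet_singleton _)
    rw [this, lintegral_indicator_one hms,
      hQ.measure_interarrival _ (measurableSet_singleton _), expMeasure_singleton]
  simp only [hzero, lintegral_zero] at key
  have hset : MeasurableSet {ω | τ (k + 1) ω = Y ω} := measurableSet_eq_fun (hτ (k + 1)) hYm
  have h0 : μ {ω | τ (k + 1) ω = Y ω} = 0 := by
    rw [← lintegral_indicator_one hset, ← key]
    refine lintegral_congr fun ω => ?_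
    simp [indicator]
  rw [ae_iff]
  refine measure_mono_null (fun ω hω => ?_) h0
  have : arrival τ m ω + ξ m ω = arrival τ (k + 1) ω := not_not.1 hω
  show τ (k + 1) ω = arrival τ m ω + ξ m ω - arrival τ k ω
  rw [arrival_succ] at this
  linarith

lemma IsQueue.ae_regular [IsProbabilityMeasure μ] (hQ : IsQueue μ Λ G τ ξ) (hτ : ∀ n, Measurable (τ n))
    (hξ : ∀ n, Measurable (ξ n)) : ∀ᵐ ω ∂μ, Regular τ ξ ω := by
  have hne : ∀ᵐ ω ∂μ, ∀ m n, m < n → arrival τ m ω + ξ m ω ≠ arrival τ n ω :=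
    ae_all_iff.2 fun m => ae_all_iff.2 fun n => ae_all_iff.2 fun hmn => hQ.ae_ne hτ hξ m n hmn
  filter_upwards [hQ.ae_pos, hQ.ae_frequently hτ, hne] with ω h1 h2 h3
  refine ⟨h1, ?_, h3⟩
  have hns : ¬ Summable fun n => τ n ω := fun hs =>
    h2 ((hs.tendsto_atTop_zero.eventually_lt_const zero_lt_one).mono fun n hn => not_lt.2 hn.le)
  have := (not_summable_iff_tendsto_nat_atTop_of_nonneg fun n => (h1 n).le).1 hns
  exact this.comp (tendsto_add_atTop_nat 1)

end Regularity

/-! ### The probability that the system is empty at a given time -/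

section Idle

/-- Whether the system is empty at time `u` is decided by the first customer and, from their
arrival on, by the later ones. -/
lemma idleAt_future_zero_iff {u : ℝ} :
    IdleAt u (future τ ξ 0 ω) ↔
      ¬ (τ 0 ω ≤ u ∧ u < τ 0 ω + ξ 0 ω) ∧ IdleAt (u - τ 0 ω) (future τ ξ 1 ω) := by
  have h0 : InService (fun j => τ (0 + j)) (fun j => ξ (0 + j)) ω 0 u ↔
      (τ 0 ω ≤ u ∧ u < τ 0 ω + ξ 0 ω) := by simp [InService, arrival]
  have hsucc : ∀ j, InService (fun j => τ (0 + j)) (fun j => ξ (0 + j)) ω (j + 1) u ↔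
      InService (fun j => τ (1 + j)) (fun j => ξ (1 + j)) ω j (u - τ 0 ω) := fun j => by
    have h1 : arrival (fun j => τ (0 + j)) (j + 1) ω =
        τ 0 ω + arrival (fun j => τ (1 + j)) j ω := by
      rw [arrival, Finset.sum_range_succ', add_comm]
      simp [arrival, add_comm]
    rw [InService, InService, h1, show 0 + (j + 1) = 1 + j by omega]
    constructor <;> rintro ⟨h2, h3⟩ <;> constructor <;> linarith
  rw [idleAt_future_iff, idleAt_future_iff, ← h0]
  simp only [← hsucc]
  constructor
  · exact fun h => ⟨h 0, fun j => h (j + 1)⟩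
  · rintro ⟨h1, h2⟩ (_ | j)
    exacts [h1, h2 j]

variable [MeasurableSpace Ω] {μ : Measure Ω} {Λ : ℝ} {G : Measure ℝ}

/-- The probability that the system, idle at time `0`, is empty at time `u`. -/
noncomputable def idleProb (μ : Measure Ω) (τ ξ : ℕ → Ω → ℝ) (u : ℝ) : ℝ≥0∞ :=
  μ {ω | IdleAt u (future τ ξ 0 ω)}

lemma idleProb_eq_map (hτ : ∀ n, Measurable (τ n)) (hξ : ∀ n, Measurable (ξ n)) (u : ℝ) :
    idleProb μ τ ξ u = μ.map (future τ ξ 0) {w | IdleAt u w} := by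
  rw [Measure.map_apply (measurable_future (fun j _ => hτ j) fun j _ => hξ j)
    (measurableSet_idleAt_left u)]
  rfl

lemma measurable_idleProb [IsProbabilityMeasure μ] (hτ : ∀ n, Measurable (τ n))
    (hξ : ∀ n, Measurable (ξ n)) : Measurable (idleProb μ τ ξ) := by
  have : idleProb μ τ ξ = fun u => μ.map (future τ ξ 0) (Prod.mk u ⁻¹' {p | IdleAt p.1 p.2}) :=
    funext fun u => idleProb_eq_map hτ hξ u
  rw [this]
  exact measurable_measure_prodMk_left measurableSet_idleAt

lemma idleProb_le_one [IsProbabilityMeasure μ] (u : ℝ) : idleProb μ τ ξ u ≤ 1 := prob_le_one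

lemma IsQueue.measure_idleAt_future [IsProbabilityMeasure μ] (hQ : IsQueue μ Λ G τ ξ)
    (hτ : ∀ n, Measurable (τ n)) (hξ : ∀ n, Measurable (ξ n)) (n : ℕ) (u : ℝ) :
    μ {ω | IdleAt u (future τ ξ n ω)} = idleProb μ τ ξ u := by
  rw [idleProb_eq_map hτ hξ, ← hQ.map_future hτ hξ n,
    Measure.map_apply (measurable_future (fun j _ => hτ j) fun j _ => hξ j)
    (measurableSet_idleAt_left u)]
  rfl

lemma IsQueue.idleProb_of_neg [IsProbabilityMeasure μ] (hQ : IsQueue μ Λ G τ ξ)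
    {u : ℝ} (hu : u < 0) : idleProb μ τ ξ u = 1 := by
  have h : ∀ᵐ ω ∂μ, IdleAt u (future τ ξ 0 ω) := by
    filter_upwards [hQ.ae_pos] with ω hω j hj
    have h0 : 0 ≤ arrival (fun j w => w (Sum.inl j)) j (future τ ξ 0 ω) :=
      Finset.sum_nonneg fun m _ => (hω (0 + m)).le
    have := hj.1
    linarith
  refine le_antisymm prob_le_one ?_
  rw [← measure_univ (μ := μ)]
  exact measure_mono_ae (h.mono fun ω hω _ => hω)

lemma IsQueue.isProbabilityMeasure_service [IsProbabilityMeasure μ] (hQ : IsQueue μ Λ G τ ξ) :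
    IsProbabilityMeasure G := (hQ.hasLaw_service 0).isProbabilityMeasure_iff.1 inferInstance

/-- First-step analysis of the empty probability, by conditioning on the first arrival. -/
lemma IsQueue.idleProb_eq [IsProbabilityMeasure μ] (hQ : IsQueue μ Λ G τ ξ)
    (hτ : ∀ n, Measurable (τ n)) (hξ : ∀ n, Measurable (ξ n)) (u : ℝ) :
    idleProb μ τ ξ u =
      ∫⁻ s, (if s ≤ u then G (Iic (u - s)) * idleProb μ τ ξ (u - s) else 1) ∂expMeasure Λ := by
  have hp := measurable_idleProb (μ := μ) hτ hξ
  have hfut := measurable_future (n := 1) (fun j _ => hτ j) fun j _ => hξ j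
  let A : Set ((ℝ × ℝ) × (ℕ ⊕ ℕ → ℝ)) :=
    {p | ¬ (p.1.1 ≤ u ∧ u < p.1.1 + p.1.2) ∧ IdleAt (u - p.1.1) p.2}
  have hB : MeasurableSet {p : ℝ × ℝ | ¬ (p.1 ≤ u ∧ u < p.1 + p.2)} :=
    ((measurableSet_le measurable_fst measurable_const).inter
      (measurableSet_lt measurable_const (measurable_fst.add measurable_snd))).compl
  have hA : MeasurableSet A := by
    refine (measurable_fst hB).inter ?_
    exact ((by fun_prop : Measurable fun p : (ℝ × ℝ) × (ℕ ⊕ ℕ → ℝ) => (u - p.1.1, p.2))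
      measurableSet_idleAt)
  -- the first customer is independent of the later ones
  have hind1 : IndepFun (fun ω => (τ 0 ω, ξ 0 ω)) (future τ ξ 1) μ := by
    refine hQ.indepFun_of_disjoint hτ hξ {Sum.inl 0, Sum.inr 0} {Sum.inl 0, Sum.inr 0}ᶜ
      disjoint_compl_right ?_ ?_
    · exact @Measurable.prodMk _ _ _ _ _ (_) _ _ (measurable_sigmaOf_interarrival (by simp))
        (measurable_sigmaOf_service (by simp))
    · refine @measurable_future _ _ _ _ (_) (fun j hj => measurable_sigmaOf_interarrival ?_)
        (fun j hj => measurable_sigmaOf_service ?_) <;> simp <;> omega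
  have hind2 : IndepFun (τ 0) (ξ 0) μ :=
    hQ.indepFun_of_disjoint hτ hξ {Sum.inl 0} {Sum.inr 0} (by simp)
      (measurable_sigmaOf_interarrival rfl) (measurable_sigmaOf_service rfl)
  have hset : MeasurableSet {ω | IdleAt u (future τ ξ 0 ω)} :=
    (measurable_future (fun j _ => hτ j) fun j _ => hξ j) (measurableSet_idleAt_left u)
  have e1 : idleProb μ τ ξ u =
      ∫⁻ ω, (if ((τ 0 ω, ξ 0 ω), future τ ξ 1 ω) ∈ A then 1 else 0) ∂μ := by
    rw [idleProb, ← lintegral_ite_one hset]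
    refine lintegral_congr fun ω => ?_
    exact if_congr idleAt_future_zero_iff rfl rfl
  have e2 : ∀ ω, ∫⁻ ω', (if ((τ 0 ω, ξ 0 ω), future τ ξ 1 ω') ∈ A then 1 else 0) ∂μ =
      if ¬ (τ 0 ω ≤ u ∧ u < τ 0 ω + ξ 0 ω) then idleProb μ τ ξ (u - τ 0 ω) else 0 := fun ω => by
    by_cases h : ¬ (τ 0 ω ≤ u ∧ u < τ 0 ω + ξ 0 ω)
    · have hm : MeasurableSet {ω' | IdleAt (u - τ 0 ω) (future τ ξ 1 ω')} :=
        hfut (measurableSet_idleAt_left _)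
      rw [if_pos h, ← hQ.measure_idleAt_future hτ hξ 1, ← lintegral_ite_one hm]
      exact lintegral_congr fun ω' => if_congr (and_iff_right h) rfl rfl
    · rw [if_neg h]
      refine (lintegral_congr fun ω' => if_neg ?_).trans lintegral_zero
      exact fun h' => h h'.1
  have hΦ : Measurable fun p : ℝ × ℝ =>
      if ¬ (p.1 ≤ u ∧ u < p.1 + p.2) then idleProb μ τ ξ (u - p.1) else 0 :=
    Measurable.ite hB (hp.comp (by fun_prop)) measurable_const
  rw [e1, lintegral_comp_of_indepFun hind1 ((hτ 0).prodMk (hξ 0)) hfut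
    (Φ := fun p => if p ∈ A then 1 else 0) (Measurable.ite hA measurable_const measurable_const)]
  simp only [e2]
  rw [lintegral_comp_of_indepFun hind2 (hτ 0) (hξ 0) hΦ]
  have hg : Measurable fun s => if s ≤ u then G (Iic (u - s)) * idleProb μ τ ξ (u - s) else 1 := by
    refine Measurable.ite measurableSet_Iic (Measurable.mul ?_ (hp.comp (by fun_prop)))
      measurable_const
    exact Antitone.measurable fun x y hxy => measure_mono (Iic_subset_Iic.2 (by linarith))
  rw [← (hQ.hasLaw_interarrival 0).map_eq, lintegral_map hg (hτ 0)]
  refine lintegral_congr fun ω => ?_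
  by_cases h : τ 0 ω ≤ u
  · have hm : MeasurableSet {ω' | ξ 0 ω' ∈ Iic (u - τ 0 ω)} := hξ 0 measurableSet_Iic
    rw [if_pos h, ← hQ.measure_service 0 measurableSet_Iic, mul_comm, ← lintegral_ite_one hm,
      ← lintegral_const_mul' _ _
        (show idleProb μ τ ξ (u - τ 0 ω) ≠ ∞ from measure_ne_top _ _)]
    refine lintegral_congr fun ω' => ?_
    by_cases h' : ξ 0 ω' ≤ u - τ 0 ω
    · have h'' : ¬ (u < τ 0 ω + ξ 0 ω') := by linarith
      simp [h', h'']
    · have h'' : u < τ 0 ω + ξ 0 ω' := by linarith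
      simp [h, h', h'']
  · rw [if_neg h]
    simp [h, hQ.idleProb_of_neg (show u - τ 0 ω < 0 by linarith)]

end Idle

section IdleFormula

variable [MeasurableSpace Ω] {μ : Measure Ω} {Λ : ℝ} {G : Measure ℝ}

lemma intervalIntegrable_of_bounded {f : ℝ → ℝ} (hf : Measurable f) {a b C : ℝ}
    (hC : ∀ x ∈ uIoc a b, ‖f x‖ ≤ C) : IntervalIntegrable f volume a b := by
  rw [intervalIntegrable_iff]
  refine Measure.integrableOn_of_bounded (M := C) (by simp [uIoc]) hf.aestronglyMeasurable ?_
  exact (ae_restrict_iff' measurableSet_uIoc).2 (Eventually.of_forall hC)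

/-- The law `G` enters through its distribution function `cdf G`, the probability of emptiness
through its real value. The integral equation is the first-step analysis after multiplication by
`exp (Λ u)`. -/
lemma IsQueue.exp_mul_idleProb [IsProbabilityMeasure μ] (hQ : IsQueue μ Λ G τ ξ)
    (hτ : ∀ n, Measurable (τ n)) (hξ : ∀ n, Measurable (ξ n)) {u : ℝ} (hu : 0 ≤ u) :
    Real.exp (Λ * u) * (idleProb μ τ ξ u).toReal =
      1 + ∫ w in 0..u, Λ * Real.exp (Λ * w) * cdf G w * (idleProb μ τ ξ w).toReal := by
  have := hQ.isProbabilityMeasure_service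
  have hΛ := hQ.rate_pos
  have := isProbabilityMeasure_expMeasure hΛ
  have hp := measurable_idleProb (μ := μ) hτ hξ
  set P : ℝ → ℝ := fun w => (idleProb μ τ ξ w).toReal with hP
  have hPm : Measurable P := hp.ennreal_toReal
  have hP0 : ∀ w, 0 ≤ P w := fun w => ENNReal.toReal_nonneg
  have hP1 : ∀ w, P w ≤ 1 := fun w =>
    ENNReal.toReal_le_of_le_ofReal zero_le_one (by simpa using idleProb_le_one w)
  have hPof : ∀ w, idleProb μ τ ξ w = ENNReal.ofReal (P w) := fun w =>
    (ENNReal.ofReal_toReal (ne_top_of_le_ne_top ENNReal.one_ne_top (idleProb_le_one w))).symm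
  have hF0 := cdf_nonneg G
  have hF1 := cdf_le_one G
  have hFm : Measurable (cdf G) := (monotone_cdf G).measurable
  have hg : Measurable fun s => if s ≤ u then G (Iic (u - s)) * idleProb μ τ ξ (u - s) else 0 := by
    refine Measurable.ite measurableSet_Iic (Measurable.mul ?_ (hp.comp (by fun_prop)))
      measurable_const
    exact Antitone.measurable fun x y hxy => measure_mono (Iic_subset_Iic.2 (by linarith))
  let f : ℝ → ℝ := fun v => Λ * Real.exp (-(Λ * v)) * cdf G (u - v) * P (u - v)
  have hfm : Measurable f := by fun_prop
  have hf0 : ∀ v, 0 ≤ f v := fun v => by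
    have := hF0 (u - v); have := hP0 (u - v); positivity
  have hfint : IntegrableOn f (Ioc 0 u) := by
    rw [← intervalIntegrable_iff_integrableOn_Ioc_of_le hu]
    refine intervalIntegrable_of_bounded hfm (C := Λ) fun v hv => ?_
    rw [uIoc_of_le hu] at hv
    rw [Real.norm_of_nonneg (hf0 v)]
    have h1 : Real.exp (-(Λ * v)) ≤ 1 := Real.exp_le_one_iff.2 (by have := hv.1; nlinarith)
    calc f v ≤ Λ * 1 * 1 * 1 := by
          have := hF0 (u - v); have := hP0 (u - v); have := hF1 (u - v); have := hP1 (u - v)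
          simp only [f]
          gcongr
      _ = Λ := by ring
  have e0 : idleProb μ τ ξ u = ENNReal.ofReal (Real.exp (-(Λ * u))) +
      ENNReal.ofReal (∫ v in 0..u, f v) := by
    rw [hQ.idleProb_eq hτ hξ u, ← expMeasure_Ioi hΛ hu]
    have hsplit : ∀ s, (if s ≤ u then G (Iic (u - s)) * idleProb μ τ ξ (u - s) else 1) =
        (Ioi u).indicator 1 s +
          (if s ≤ u then G (Iic (u - s)) * idleProb μ τ ξ (u - s) else 0) := fun s => by
      by_cases h : s ≤ u
      · simp [h]
      · simp [h, not_le.1 h]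
    simp only [hsplit]
    rw [lintegral_add_left (measurable_one.indicator measurableSet_Ioi),
      lintegral_indicator_one measurableSet_Ioi, lintegral_expMeasure hΛ hg]
    congr 1
    rw [intervalIntegral.integral_of_le hu, ofReal_integral_eq_lintegral_ofReal hfint
      (Eventually.of_forall hf0), ← lintegral_const_mul' _ _ ENNReal.ofReal_ne_top,
      restrict_Ioc_eq_restrict_Icc,
      ← lintegral_indicator measurableSet_Ici, ← lintegral_indicator measurableSet_Icc]
    refine lintegral_congr fun v => ?_
    by_cases h0 : 0 ≤ v
    · by_cases h1 : v ≤ u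
      · rw [indicator_of_mem (show v ∈ Ici 0 from h0), indicator_of_mem (show v ∈ Icc 0 u from ⟨h0, h1⟩),
          if_pos h1, expMeasure_Ioi hΛ h0, ← ofReal_cdf, hPof, ← ENNReal.ofReal_mul (hF0 _),
          ← ENNReal.ofReal_mul (mul_nonneg (hF0 _) (hP0 _)), ← ENNReal.ofReal_mul hΛ.le]
        congr 1
        simp only [f]
        ring
      · simp [h0, h1]
    · simp [h0]
  have hint0 : 0 ≤ ∫ v in 0..u, f v := intervalIntegral.integral_nonneg hu fun v _ => hf0 v
  have e1 : P u = Real.exp (-(Λ * u)) + ∫ v in 0..u, f v := by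
    rw [hP]
    simp only
    rw [e0, ← ENNReal.ofReal_add (Real.exp_pos _).le hint0,
      ENNReal.toReal_ofReal (add_nonneg (Real.exp_pos _).le hint0)]
  have e2 : ∫ v in 0..u, f v = Real.exp (-(Λ * u)) *
      ∫ w in 0..u, Λ * Real.exp (Λ * w) * cdf G w * P w := by
    have h1 : ∀ v, f v = (fun w => Real.exp (-(Λ * u)) *
        (Λ * Real.exp (Λ * w) * cdf G w * P w)) (u - v) := fun v => by
      have : Real.exp (-(Λ * v)) = Real.exp (-(Λ * u)) * Real.exp (Λ * (u - v)) := by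
        rw [← Real.exp_add]; congr 1; ring
      simp only [f, this]
      ring
    simp only [h1]
    rw [intervalIntegral.integral_comp_sub_left
      (fun w => Real.exp (-(Λ * u)) * (Λ * Real.exp (Λ * w) * cdf G w * P w)) u,
      intervalIntegral.integral_const_mul]
    simp
  have hexp : Real.exp (Λ * u) * Real.exp (-(Λ * u)) = 1 := by
    rw [← Real.exp_add]; simp
  change Real.exp (Λ * u) * P u = 1 + ∫ w in 0..u, Λ * Real.exp (Λ * w) * cdf G w * P w
  rw [e1, e2, mul_add, ← mul_assoc, hexp, one_mul]

lemma measurable_toReal_idleProb [IsProbabilityMeasure μ]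
    (hτ : ∀ n, Measurable (τ n)) (hξ : ∀ n, Measurable (ξ n)) :
    Measurable fun u => (idleProb μ τ ξ u).toReal := (measurable_idleProb hτ hξ).ennreal_toReal

lemma toReal_idleProb_le_one [IsProbabilityMeasure μ] (u : ℝ) :
    (idleProb μ τ ξ u).toReal ≤ 1 :=
  ENNReal.toReal_le_of_le_ofReal zero_le_one (by simpa using idleProb_le_one u)

/-- The primitive of a right-continuous function has it as right derivative. -/
lemma hasDerivWithinAt_primitive {f : ℝ → ℝ} (hf : Measurable f) {a u : ℝ}
    (hint : IntervalIntegrable f volume a u) (hc : ContinuousWithinAt f (Ici u) u) :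
    HasDerivWithinAt (fun x => ∫ w in a..x, f w) (f u) (Ici u) u :=
  intervalIntegral.integral_hasDerivWithinAt_right hint
    (hf.stronglyMeasurable.stronglyMeasurableAtFilter)
    (hc.mono Ioi_subset_Ici_self)

lemma IsQueue.hasDerivWithinAt_idleProb [IsProbabilityMeasure μ] (hQ : IsQueue μ Λ G τ ξ)
    (hτ : ∀ n, Measurable (τ n)) (hξ : ∀ n, Measurable (ξ n)) :
    ContinuousOn (fun u => (idleProb μ τ ξ u).toReal) (Ici 0) ∧
    ∀ u, 0 ≤ u → HasDerivWithinAt (fun u => (idleProb μ τ ξ u).toReal)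
      (-(Λ * (1 - cdf G u) * (idleProb μ τ ξ u).toReal)) (Ici u) u := by
  have := hQ.isProbabilityMeasure_service
  have hΛ := hQ.rate_pos
  set P : ℝ → ℝ := fun w => (idleProb μ τ ξ w).toReal with hP
  have hPm : Measurable P := measurable_toReal_idleProb hτ hξ
  have hP0 : ∀ w, 0 ≤ P w := fun w => ENNReal.toReal_nonneg
  have hP1 : ∀ w, P w ≤ 1 := fun w => toReal_idleProb_le_one w
  have hF0 := cdf_nonneg G
  have hF1 := cdf_le_one G
  have hFm : Measurable (cdf G) := (monotone_cdf G).measurable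
  let f : ℝ → ℝ := fun w => Λ * Real.exp (Λ * w) * cdf G w * P w
  have hfm : Measurable f := by fun_prop
  have hint : ∀ u, 0 ≤ u → IntervalIntegrable f volume 0 u := fun u hu => by
    refine intervalIntegrable_of_bounded hfm (C := Λ * Real.exp (Λ * u)) fun v hv => ?_
    rw [uIoc_of_le hu] at hv
    have h0 : 0 ≤ f v := by
      have := hF0 v; have := hP0 v
      simp only [f]
      positivity
    rw [Real.norm_of_nonneg h0]
    calc f v ≤ Λ * Real.exp (Λ * u) * 1 * 1 := by
          have := hF0 v; have := hP0 v; have := hF1 v; have := hP1 v; have := hv.2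
          simp only [f]
          gcongr
      _ = Λ * Real.exp (Λ * u) := by ring
  have hPeq : ∀ u, 0 ≤ u → P u = Real.exp (-(Λ * u)) * (1 + ∫ w in 0..u, f w) := fun u hu => by
    rw [← hQ.exp_mul_idleProb hτ hξ hu, ← mul_assoc, ← Real.exp_add]
    simp [hP]
  have hcont : ContinuousOn P (Ici 0) := by
    intro u hu
    have h1 : ContinuousOn (fun x => ∫ w in 0..x, f w) (Icc 0 (u + 1)) := by
      have h := intervalIntegral.continuousOn_primitive_interval' (hint (u + 1) (by
        have : (0 : ℝ) ≤ u := hu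
        linarith)) left_mem_uIcc
      rwa [uIcc_of_le (by have : (0 : ℝ) ≤ u := hu; linarith)] at h
    have h2 : ContinuousOn P (Icc 0 (u + 1)) := by
      refine ContinuousOn.congr (f := fun u => Real.exp (-(Λ * u)) * (1 + ∫ w in 0..u, f w)) ?_
        fun x hx => hPeq x hx.1
      exact (by fun_prop : Continuous fun u : ℝ => Real.exp (-(Λ * u))).continuousOn.mul
        (continuousOn_const.add h1)
    refine (h2 u ⟨hu, by linarith⟩).mono_of_mem_nhdsWithin ?_
    exact inter_mem_nhdsWithin (Ici 0) (Iic_mem_nhds (by linarith))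
  refine ⟨hcont, fun u hu => ?_⟩
  have hPc : ContinuousWithinAt P (Ici u) u := (hcont u hu).mono (Ici_subset_Ici.2 hu)
  have hfc : ContinuousWithinAt f (Ici u) u := by
    refine ContinuousWithinAt.mul (ContinuousWithinAt.mul ?_ ((cdf G).right_continuous u)) hPc
    exact (by fun_prop : Continuous fun w : ℝ => Λ * Real.exp (Λ * w)).continuousWithinAt
  have hd1 := hasDerivWithinAt_primitive hfm (hint u hu) hfc
  have hd2 : HasDerivAt (fun u : ℝ => Real.exp (-(Λ * u))) (Real.exp (-(Λ * u)) * (-(Λ * 1))) u :=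
    (((hasDerivAt_id u).const_mul Λ).neg).exp
  have hd3 := hd2.hasDerivWithinAt (s := Ici u).mul (hd1.const_add 1)
  refine (hd3.congr_of_mem (fun x hx => hPeq x (hu.trans hx)) self_mem_Ici).congr_deriv ?_
  have hexp : Real.exp (-(Λ * u)) * Real.exp (Λ * u) = 1 := by
    rw [← Real.exp_add]; simp
  have e := hPeq u hu
  change _ = -(Λ * (1 - cdf G u) * P u)
  calc Real.exp (-(Λ * u)) * (-(Λ * 1)) * (1 + ∫ w in 0..u, f w) + Real.exp (-(Λ * u)) * f u
      = -Λ * (Real.exp (-(Λ * u)) * (1 + ∫ w in 0..u, f w)) +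
        (Real.exp (-(Λ * u)) * Real.exp (Λ * u)) * (Λ * cdf G u * P u) := by simp only [f]; ring
    _ = -(Λ * (1 - cdf G u) * P u) := by rw [← e, hexp]; ring

/-- The probability of emptiness solves the differential equation `p' = -Λ (1 - cdf G) p` in the sense
of right derivatives, which suffices as it is continuous. -/
lemma IsQueue.toReal_idleProb [IsProbabilityMeasure μ] (hQ : IsQueue μ Λ G τ ξ)
    (hτ : ∀ n, Measurable (τ n)) (hξ : ∀ n, Measurable (ξ n)) {u : ℝ} (hu : 0 ≤ u) :
    (idleProb μ τ ξ u).toReal = Real.exp (-(Λ * ∫ w in 0..u, (1 - cdf G w))) := by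
  obtain ⟨hcont, hder⟩ := hQ.hasDerivWithinAt_idleProb hτ hξ
  set P : ℝ → ℝ := fun w => (idleProb μ τ ξ w).toReal with hP
  have hFm : Measurable fun w => 1 - cdf G w := measurable_const.sub (monotone_cdf G).measurable
  have hint : ∀ a b, IntervalIntegrable (fun w => 1 - cdf G w) volume a b := fun a b => by
    refine intervalIntegrable_of_bounded hFm (C := 1) fun v _ => ?_
    have := cdf_nonneg G v
    have := cdf_le_one G v
    rw [Real.norm_of_nonneg (by linarith)]
    linarith
  let E : ℝ → ℝ := fun u => Real.exp (Λ * ∫ w in 0..u, (1 - cdf G w))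
  have hE : ∀ u, HasDerivWithinAt E (E u * (Λ * (1 - cdf G u))) (Ici u) u := fun u =>
    (((hasDerivWithinAt_primitive hFm (hint 0 u)
      (continuousWithinAt_const.sub ((cdf G).right_continuous u))).const_mul Λ)).exp
  have hEc : Continuous E :=
    Real.continuous_exp.comp (continuous_const.mul (intervalIntegral.continuous_primitive hint 0))
  have key := constant_of_has_deriv_right_zero (f := fun x => P x * E x) (a := 0) (b := u)
    ((hcont.mono Icc_subset_Ici_self).mul hEc.continuousOn) (fun x hx => by
      refine ((hder x hx.1).mul (hE x)).congr_deriv ?_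
      simp only [hP]
      ring) u ⟨hu, le_rfl⟩
  have hP0 : P 0 = 1 := by
    have := hQ.exp_mul_idleProb hτ hξ le_rfl
    simpa using this
  have hE0 : E 0 = 1 := by simp [E]
  simp only [hP0, hE0, mul_one] at key
  rw [Real.exp_neg]
  exact eq_inv_of_mul_eq_one_left key

end IdleFormula

/-! ### Moments through tails -/

section Moments

variable [MeasurableSpace Ω] {μ : Measure Ω} {Λ : ℝ} {G : Measure ℝ}

lemma ae_nonneg_of_Iio_zero {m : Measure ℝ} (hm : m (Iio 0) = 0) : ∀ᵐ x ∂m, 0 ≤ x :=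
  (measure_eq_zero_iff_ae_notMem.1 hm).mono fun _ hx => not_lt.1 hx

lemma lintegral_pow_succ_eq {f : Ω → ℝ} (hf0 : 0 ≤ᵐ[μ] f) (hf : AEMeasurable f μ) (j : ℕ) :
    ∫⁻ ω, ENNReal.ofReal (f ω ^ (j + 1)) ∂μ =
      (j + 1) * ∫⁻ t in Ioi 0, μ {ω | t < f ω} * ENNReal.ofReal (t ^ j) := by
  rw [← lintegral_comp_eq_lintegral_meas_lt_mul μ hf0 hf
    (fun t _ => (continuous_pow j).intervalIntegrable _ _)
    ((ae_restrict_iff' measurableSet_Ioi).2 (Eventually.of_forall fun t ht => pow_nonneg (le_of_lt ht) j)),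
    ← lintegral_const_mul' _ _ (by simp)]
  refine lintegral_congr fun ω => ?_
  have h : ((j : ℝ≥0∞) + 1) = ENNReal.ofReal (j + 1) := by
    rw [ENNReal.ofReal_add (by positivity) zero_le_one]; simp
  rw [h, ← ENNReal.ofReal_mul (by positivity), integral_pow]
  congr 1
  field_simp
  simp

/-- The density `u ↦ ℙ(ξ > u) ℙ(empty at u)` on `[0, ∞)`. -/
noncomputable def lastDensity (μ : Measure Ω) (G : Measure ℝ) (τ ξ : ℕ → Ω → ℝ) (u : ℝ) : ℝ≥0∞ :=
  if 0 ≤ u then G (Ioi u) * idleProb μ τ ξ u else 0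

lemma measurable_measure_Ioi : Measurable fun u : ℝ => G (Ioi u) :=
  Antitone.measurable fun _ _ hxy => measure_mono (Ioi_subset_Ioi hxy)

lemma measurable_lastDensity [IsProbabilityMeasure μ]
    (hτ : ∀ n, Measurable (τ n)) (hξ : ∀ n, Measurable (ξ n)) :
    Measurable (lastDensity μ G τ ξ) :=
  Measurable.ite measurableSet_Ici (measurable_measure_Ioi.mul (measurable_idleProb hτ hξ))
    measurable_const

/-- The measure with density `Λ ℙ(ξ > u) ℙ(empty at u)` on `[0, ∞)`. -/
noncomputable def lastMeasure (μ : Measure Ω) (Λ : ℝ) (G : Measure ℝ) (τ ξ : ℕ → Ω → ℝ) :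
    Measure ℝ := ENNReal.ofReal Λ • volume.withDensity (lastDensity μ G τ ξ)

lemma measure_Ioi_eq [IsProbabilityMeasure G] (u : ℝ) :
    G (Ioi u) = ENNReal.ofReal (1 - cdf G u) := by
  rw [← compl_Iic, prob_compl_eq_one_sub measurableSet_Iic, ← ofReal_cdf,
    ENNReal.ofReal_sub _ (cdf_nonneg G u), ENNReal.ofReal_one]

lemma tendsto_integral_one_sub_cdf [IsProbabilityMeasure G] (hG : G (Iio 0) = 0)
    (hint : Integrable (fun s : ℝ => s) G) :
    Tendsto (fun u : ℝ => ∫ w in 0..u, (1 - cdf G w)) atTop (𝓝 (∫ s, s ∂G)) := by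
  have hF0 : ∀ u, 0 ≤ 1 - cdf G u := fun u => by linarith [cdf_le_one G u]
  have hnn : 0 ≤ᵐ[G] fun s : ℝ => s := ae_nonneg_of_Iio_zero hG
  have h := lintegral_pow_succ_eq (μ := G) hnn measurable_id.aemeasurable 0
  have hm : Measurable fun u => 1 - cdf G u := measurable_const.sub (monotone_cdf G).measurable
  have hl : ∫⁻ u in Ioi 0, ENNReal.ofReal (1 - cdf G u) = ENNReal.ofReal (∫ s, s ∂G) := by
    rw [ofReal_integral_eq_lintegral_ofReal hint hnn]
    simp only [zero_add, pow_one, pow_zero, ENNReal.ofReal_one, mul_one, Nat.cast_zero,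
      one_mul] at h
    rw [h]
    exact lintegral_congr fun u => (measure_Ioi_eq u).symm
  have hI : IntegrableOn (fun u => 1 - cdf G u) (Ioi 0) := by
    refine ⟨hm.aestronglyMeasurable, ?_⟩
    rw [hasFiniteIntegral_iff_ofReal (Eventually.of_forall hF0), hl]
    exact ENNReal.ofReal_lt_top
  have heq : ∫ u in Ioi 0, (1 - cdf G u) = ∫ s, s ∂G := by
    rw [integral_eq_lintegral_of_nonneg_ae (Eventually.of_forall hF0) hm.aestronglyMeasurable, hl,
      ENNReal.toReal_ofReal (integral_nonneg_of_ae hnn)]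
  rw [← heq]
  exact intervalIntegral_tendsto_integral_Ioi 0 hI tendsto_id

lemma lintegral_lastMeasure [IsProbabilityMeasure μ]
    (hτ : ∀ n, Measurable (τ n)) (hξ : ∀ n, Measurable (ξ n)) {h : ℝ → ℝ≥0∞} (hh : Measurable h) :
    ∫⁻ u, h u ∂lastMeasure μ Λ G τ ξ =
      ENNReal.ofReal Λ * ∫⁻ u in Ioi 0, G (Ioi u) * idleProb μ τ ξ u * h u := by
  rw [lastMeasure, lintegral_smul_measure, lintegral_withDensity_eq_lintegral_mul _
    (measurable_lastDensity hτ hξ) hh, smul_eq_mul, restrict_Ioi_eq_restrict_Ici,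
    ← lintegral_indicator measurableSet_Ici]
  congr 1
  refine lintegral_congr fun u => ?_
  by_cases hu : 0 ≤ u <;> simp [lastDensity, hu]

/-- The measure `lastMeasure` is minus the derivative of the probability of emptiness, so that its
mass is the total decrease of the latter. -/
lemma IsQueue.lastMeasure_univ [IsProbabilityMeasure μ] (hQ : IsQueue μ Λ G τ ξ)
    (hτ : ∀ n, Measurable (τ n)) (hξ : ∀ n, Measurable (ξ n))
    (hint : Integrable (fun s : ℝ => s) G) :
    lastMeasure μ Λ G τ ξ univ = ENNReal.ofReal (1 - Real.exp (-(Λ * ∫ s, s ∂G))) := by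
  have := hQ.isProbabilityMeasure_service
  have hΛ := hQ.rate_pos
  obtain ⟨hcont, hder⟩ := hQ.hasDerivWithinAt_idleProb hτ hξ
  set P : ℝ → ℝ := fun w => (idleProb μ τ ξ w).toReal with hP
  have hPm : Measurable P := measurable_toReal_idleProb hτ hξ
  have hP0 : ∀ w, 0 ≤ P w := fun w => ENNReal.toReal_nonneg
  have hP1 : ∀ w, P w ≤ 1 := fun w => toReal_idleProb_le_one w
  have hF0 : ∀ u, 0 ≤ 1 - cdf G u := fun u => by linarith [cdf_le_one G u]
  have hF1 : ∀ u, 1 - cdf G u ≤ 1 := fun u => by linarith [cdf_nonneg G u]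
  have hm : Measurable fun u => 1 - cdf G u := measurable_const.sub (monotone_cdf G).measurable
  let f : ℝ → ℝ := fun u => Λ * (1 - cdf G u) * P u
  have hfm : Measurable f := (hm.const_mul Λ).mul hPm
  have hf0 : ∀ u, 0 ≤ f u := fun u => mul_nonneg (mul_nonneg hΛ.le (hF0 u)) (hP0 u)
  have hfint : ∀ a b, IntervalIntegrable f volume a b := fun a b => by
    refine intervalIntegrable_of_bounded hfm (C := Λ) fun v _ => ?_
    rw [Real.norm_of_nonneg (hf0 v)]
    calc f v ≤ Λ * 1 * 1 := by
          have := hF0 v; have := hP0 v; have := hF1 v; have := hP1 v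
          simp only [f]
          gcongr
      _ = Λ := by ring
  have hPzero : P 0 = 1 := by
    rw [hP]
    simp only
    rw [hQ.toReal_idleProb hτ hξ le_rfl]
    simp
  have hftc : ∀ T, 0 ≤ T → ∫ u in 0..T, f u = 1 - P T := fun T hT => by
    have := intervalIntegral.integral_eq_sub_of_hasDeriv_right_of_le (f := fun u => -P u)
      (f' := f) hT (hcont.mono Icc_subset_Ici_self).neg
      (fun x hx => ((hder x hx.1.le).neg.mono Ioi_subset_Ici_self).congr_deriv (by simp [f, hP]))
      (hfint 0 T)
    rw [this, hPzero]
    ring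
  have hlim1 : Tendsto (fun T => ENNReal.ofReal (∫ u in 0..T, f u)) atTop
      (𝓝 (ENNReal.ofReal (1 - Real.exp (-(Λ * ∫ s, s ∂G))))) := by
    have h1 : Tendsto (fun T : ℝ => 1 - Real.exp (-(Λ * ∫ w in 0..T, (1 - cdf G w)))) atTop
        (𝓝 (1 - Real.exp (-(Λ * ∫ s, s ∂G)))) :=
      ((Real.continuous_exp.tendsto _).comp
        ((tendsto_integral_one_sub_cdf hQ.service_nonneg hint).const_mul Λ).neg).const_sub 1
    refine ENNReal.tendsto_ofReal (h1.congr' ?_)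
    filter_upwards [eventually_ge_atTop 0] with T hT
    rw [hftc T hT, hP]
    simp only
    rw [hQ.toReal_idleProb hτ hξ hT]
  have hlim2 : Tendsto (fun T => ∫⁻ u in Iic T, ENNReal.ofReal (f u) ∂volume.restrict (Ioi 0)) atTop
      (𝓝 (∫⁻ u in Ioi 0, ENNReal.ofReal (f u))) :=
    (aecover_Iic tendsto_id).lintegral_tendsto_of_countably_generated
      hfm.ennreal_ofReal.aemeasurable
  have hmass : lastMeasure μ Λ G τ ξ univ = ∫⁻ u in Ioi 0, ENNReal.ofReal (f u) := by
    rw [← lintegral_one, lintegral_lastMeasure hτ hξ measurable_const,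
      ← lintegral_const_mul' _ _ ENNReal.ofReal_ne_top]
    refine lintegral_congr fun u => ?_
    have : idleProb μ τ ξ u = ENNReal.ofReal (P u) :=
      (ENNReal.ofReal_toReal (ne_top_of_le_ne_top ENNReal.one_ne_top (idleProb_le_one u))).symm
    rw [mul_one, measure_Ioi_eq, this, ← ENNReal.ofReal_mul (hF0 u), ← ENNReal.ofReal_mul hΛ.le,
      ← mul_assoc]
  rw [hmass]
  refine tendsto_nhds_unique hlim2 (hlim1.congr' ?_)
  filter_upwards [eventually_ge_atTop 0] with T hT
  rw [intervalIntegral.integral_of_le hT, ofReal_integral_eq_lintegral_ofReal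
    ((intervalIntegrable_iff_integrableOn_Ioc_of_le hT).1 (hfint 0 T)) (Eventually.of_forall hf0),
    Measure.restrict_restrict measurableSet_Iic, Iic_inter_Ioi]

/-- The density of `lastMeasure` is at most `Λ` times the tail of the service time. -/
lemma IsQueue.lintegral_pow_lastMeasure_le [IsProbabilityMeasure μ] (hQ : IsQueue μ Λ G τ ξ)
    (hτ : ∀ n, Measurable (τ n)) (hξ : ∀ n, Measurable (ξ n)) (j : ℕ) :
    (j + 1) * ∫⁻ u, ENNReal.ofReal (u ^ j) ∂lastMeasure μ Λ G τ ξ ≤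
      ENNReal.ofReal Λ * ∫⁻ s, ENNReal.ofReal (s ^ (j + 1)) ∂G := by
  have hnn : 0 ≤ᵐ[G] fun s : ℝ => s :=
    ae_nonneg_of_Iio_zero hQ.service_nonneg
  rw [lintegral_pow_succ_eq hnn measurable_id.aemeasurable j, lintegral_lastMeasure hτ hξ (by fun_prop),
    mul_left_comm]
  gcongr with u
  calc G (Ioi u) * idleProb μ τ ξ u ≤ G (Ioi u) * 1 := by gcongr; exact idleProb_le_one u
    _ = G (Ioi u) := mul_one _

end Moments

/-! ### A renewal equation for measures on `[0, ∞)` -/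

section Renewal

open Measure

/-- The convolution powers of a measure. -/
noncomputable def convPow (c : Measure ℝ) : ℕ → Measure ℝ
  | 0 => dirac 0
  | n + 1 => c ∗ convPow c n

instance sFinite_convPow (c : Measure ℝ) [SFinite c] (n : ℕ) : SFinite (convPow c n) := by
  induction n with
  | zero => rw [convPow]; infer_instance
  | succ n ih => rw [convPow]; infer_instance

variable {a c : Measure ℝ} [SFinite a] [SFinite c]

lemma convPow_univ (n : ℕ) : convPow c n univ = c univ ^ n := by
  induction n with
  | zero => simp [convPow]
  | succ n ih =>
    rw [convPow, ← lintegral_one, lintegral_conv measurable_const]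
    simp [ih, pow_succ]

lemma convPow_Iio_zero (hc : c (Iio 0) = 0) (n : ℕ) : convPow c n (Iio 0) = 0 := by
  induction n with
  | zero => simp [convPow]
  | succ n ih =>
    rw [convPow, ← lintegral_indicator_one measurableSet_Iio,
      lintegral_conv (measurable_one.indicator measurableSet_Iio)]
    have hc' : ∀ᵐ x ∂c, 0 ≤ x := ae_nonneg_of_Iio_zero hc
    have hn' : ∀ᵐ x ∂convPow c n, 0 ≤ x := ae_nonneg_of_Iio_zero ih
    rw [← lintegral_zero (μ := c)]
    refine lintegral_congr_ae ?_
    filter_upwards [hc'] with x hx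
    rw [← lintegral_zero (μ := convPow c n)]
    refine lintegral_congr_ae ?_
    filter_upwards [hn'] with y hy
    simp [add_nonneg hx hy]

/-- Iterating the renewal equation `a = δ₀ + c ∗ a`. -/
lemma eq_sum_convPow_add (ha : a = dirac 0 + c ∗ a) (N : ℕ) :
    a = ∑ n ∈ Finset.range N, convPow c n + convPow c N ∗ a := by
  induction N with
  | zero => simp [convPow]
  | succ N ih =>
    have h1 : convPow c N ∗ a = convPow c N + convPow c (N + 1) ∗ a := by
      conv_lhs => rw [ha]
      rw [conv_add, conv_dirac_zero, ← conv_assoc, conv_comm (convPow c N) c, convPow]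
    rw [Finset.sum_range_succ, add_assoc, ← h1, ← ih]

/-- The solution of the renewal equation `a = δ₀ + c ∗ a` for a measure `c` of mass less than `1` on
`[0, ∞)`. -/
lemma eq_sum_convPow (ha : a = dirac 0 + c ∗ a) (hc : c (Iio 0) = 0) (hc1 : c univ < 1)
    (hfin : ∀ t, a (Iic t) ≠ ∞) : a = Measure.sum (convPow c) := by
  have hrem : ∀ N t, (convPow c N ∗ a) (Iic t) ≤ c univ ^ N * a (Iic t) := fun N t => by
    rw [← convPow_univ, ← lintegral_indicator_one measurableSet_Iic,
      lintegral_conv (measurable_one.indicator measurableSet_Iic), mul_comm,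
      ← lintegral_const]
    have hN' : ∀ᵐ x ∂convPow c N, 0 ≤ x :=
      ae_nonneg_of_Iio_zero (convPow_Iio_zero hc N)
    refine lintegral_mono_ae ?_
    filter_upwards [hN'] with x hx
    rw [← lintegral_indicator_one measurableSet_Iic]
    refine lintegral_mono fun y => ?_
    by_cases hy : y ≤ t
    · simp only [indicator, mem_Iic, hy, if_true]
      split_ifs <;> simp
    · simp [indicator, hy, show ¬ x + y ≤ t by linarith]
  have hle : Measure.sum (convPow c) ≤ a := by
    refine Measure.le_iff.2 fun s hs => ?_
    rw [Measure.sum_apply _ hs]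
    refine ENNReal.tsum_le_of_sum_range_le fun N => ?_
    conv_rhs => rw [eq_sum_convPow_add ha N]
    simp
  refine (Measure.ext_iff_of_iUnion_eq_univ (s := fun k : ℕ => Iic (k : ℝ)) ?_).2 fun k => ?_
  · exact eq_univ_of_forall fun x => mem_iUnion.2 (exists_nat_ge x)
  ext s hs
  rw [Measure.restrict_apply hs, Measure.restrict_apply hs]
  refine le_antisymm ?_ (hle _)
  have hlim : Tendsto (fun N : ℕ => Measure.sum (convPow c) (s ∩ Iic (k : ℝ)) +
      c univ ^ N * a (Iic (k : ℝ))) atTop (𝓝 (Measure.sum (convPow c) (s ∩ Iic (k : ℝ)) + 0)) := by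
    refine Tendsto.const_add _ ?_
    rw [← zero_mul (a (Iic (k : ℝ)))]
    exact ENNReal.Tendsto.mul_const (ENNReal.tendsto_pow_atTop_nhds_zero_of_lt_one hc1)
      (Or.inr (hfin k))
  rw [add_zero] at hlim
  refine ge_of_tendsto' hlim fun N => ?_
  conv_lhs => rw [eq_sum_convPow_add ha N]
  rw [Measure.add_apply, Measure.finsetSum_apply, Measure.sum_apply _ (hs.inter measurableSet_Iic)]
  gcongr
  · exact ENNReal.sum_le_tsum _
  · exact (measure_mono inter_subset_right).trans (hrem N k)

/-- By convexity, the `j`-th moment of the `n`-th convolution power is at most that of `n` times a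
single summand. -/
lemma lintegral_pow_convPow_le (hc : c (Iio 0) = 0) (j n : ℕ) :
    ∫⁻ x, ENNReal.ofReal (x ^ j) ∂convPow c (n + 1) ≤
      (n + 1) ^ j * c univ ^ n * ∫⁻ x, ENNReal.ofReal (x ^ j) ∂c := by
  have hc' : ∀ᵐ x ∂c, 0 ≤ x := ae_nonneg_of_Iio_zero hc
  induction n with
  | zero => simp [convPow]
  | succ n ih =>
    set m := ∫⁻ x, ENNReal.ofReal (x ^ j) ∂c with hm
    have hN' : ∀ᵐ x ∂convPow c (n + 1), 0 ≤ x := ae_nonneg_of_Iio_zero (convPow_Iio_zero hc _)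
    -- the weights of the two summands in the convexity inequality
    let N : ℝ := n + 1
    have hN : 0 < N := by positivity
    let A : ℝ := (N + 1) ^ j / (N + 1)
    let B : ℝ := (N + 1) ^ j * N / ((N + 1) * N ^ j)
    have hA : 0 ≤ A := by positivity
    have hB : 0 ≤ B := by positivity
    have hAB : A + B * N ^ j = (N + 1) ^ j := by
      simp only [A, B]
      field_simp
      ring
    have hconv : ∀ x y : ℝ, 0 ≤ x → 0 ≤ y → (x + y) ^ j ≤ A * x ^ j + B * y ^ j := by
      intro x y hx hy
      have h := (convexOn_pow (𝕜 := ℝ) j).2 (mem_Ici.2 hx) (mem_Ici.2 (div_nonneg hy hN.le))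
        (show 0 ≤ 1 / (N + 1) by positivity) (show 0 ≤ N / (N + 1) by positivity)
        (by field_simp; ring)
      simp only [smul_eq_mul] at h
      have h1 : 1 / (N + 1) * x + N / (N + 1) * (y / N) = (x + y) / (N + 1) := by
        field_simp
      rw [h1, div_pow, div_le_iff₀ (by positivity), div_pow] at h
      refine h.trans_eq ?_
      simp only [A, B]
      field_simp
    have hinner : ∀ x, 0 ≤ x → ∫⁻ y, ENNReal.ofReal ((x + y) ^ j) ∂convPow c (n + 1) ≤
        ENNReal.ofReal A * ENNReal.ofReal (x ^ j) * c univ ^ (n + 1) +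
          ENNReal.ofReal B * ∫⁻ y, ENNReal.ofReal (y ^ j) ∂convPow c (n + 1) := by
      intro x hx
      rw [← convPow_univ, ← lintegral_const, ← lintegral_const_mul' _ _ ENNReal.ofReal_ne_top,
        ← lintegral_add_left measurable_const]
      refine lintegral_mono_ae ?_
      filter_upwards [hN'] with y hy
      rw [← ENNReal.ofReal_mul hA, ← ENNReal.ofReal_mul hB, ← ENNReal.ofReal_add (by positivity)
        (by positivity)]
      exact ENNReal.ofReal_le_ofReal (hconv x y hx hy)
    have hcast : ∀ k : ℕ, ((k : ℝ≥0∞) + 1) ^ j = ENNReal.ofReal (((k : ℝ) + 1) ^ j) := fun k => by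
      rw [ENNReal.ofReal_pow (by positivity), ENNReal.ofReal_add (by positivity) zero_le_one]
      simp
    rw [convPow, lintegral_conv (by fun_prop)]
    calc ∫⁻ x, ∫⁻ y, ENNReal.ofReal ((x + y) ^ j) ∂convPow c (n + 1) ∂c
        ≤ ∫⁻ x, (ENNReal.ofReal A * ENNReal.ofReal (x ^ j) * c univ ^ (n + 1) +
          ENNReal.ofReal B * ∫⁻ y, ENNReal.ofReal (y ^ j) ∂convPow c (n + 1)) ∂c :=
        lintegral_mono_ae (hc'.mono fun x hx => hinner x hx)
      _ = ENNReal.ofReal A * m * c univ ^ (n + 1) + ENNReal.ofReal B *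
          (∫⁻ y, ENNReal.ofReal (y ^ j) ∂convPow c (n + 1)) * c univ := by
        rw [lintegral_add_right _ measurable_const, lintegral_const,
          lintegral_mul_const _ (by fun_prop), lintegral_const_mul _ (by fun_prop)]
      _ ≤ ENNReal.ofReal A * m * c univ ^ (n + 1) + ENNReal.ofReal B *
          (((n : ℝ≥0∞) + 1) ^ j * c univ ^ n * m) * c univ := by gcongr
      _ = (ENNReal.ofReal A + ENNReal.ofReal B * ((n : ℝ≥0∞) + 1) ^ j) * c univ ^ (n + 1) * m := by
        ring
      _ = (((n + 1 : ℕ) : ℝ≥0∞) + 1) ^ j * c univ ^ (n + 1) * m := by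
        rw [hcast, hcast, ← ENNReal.ofReal_mul hB, ← ENNReal.ofReal_add hA (by positivity), hAB]
        simp [N]

end Renewal

/-! ### The renewal structure of a busy period -/

lemma Regular.elapsed_nonneg (h : Regular τ ξ ω) : 0 ≤ elapsed τ ξ i n ω :=
  Finset.sum_nonneg fun m _ => by
    split_ifs
    exacts [(h.pos _).le, le_rfl]

/-- At the time `u` after the start of the `i`-th busy period, this period still lasts, and customer
`n` is the last one to have arrived. -/
def residualSet (τ ξ : ℕ → Ω → ℝ) (i n : ℕ) (u : ℝ) : Set Ω :=
  {ω | InBusy τ ξ i n ω ∧ elapsed τ ξ i n ω ≤ u ∧ u - elapsed τ ξ i n ω < residual τ ξ n ω ∧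
    u - elapsed τ ξ i n ω < τ (n + 1) ω}

/-- At the time `u` after the start of the `i`-th busy period, this period still lasts, and customer
`n` is the one among those in the system who has arrived last. -/
def lastSet (τ ξ : ℕ → Ω → ℝ) (i n : ℕ) (u : ℝ) : Set Ω :=
  {ω | InBusy τ ξ i n ω ∧ elapsed τ ξ i n ω ≤ u ∧ u - elapsed τ ξ i n ω < ξ n ω ∧
    IdleAt (u - elapsed τ ξ i n ω) (future τ ξ (n + 1) ω)}

lemma measurableSet_and {α : Type*} [MeasurableSpace α] {p q : α → Prop}
    (hp : MeasurableSet {x | p x}) (hq : MeasurableSet {x | q x}) :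
    MeasurableSet {x | p x ∧ q x} := hp.inter hq

section Queue

variable [MeasurableSpace Ω] {μ : Measure Ω} {Λ : ℝ} {G : Measure ℝ}

/-- The tail of the length of the `i`-th busy period, set to `0` on the negative half-line. -/
noncomputable def busyTail (μ : Measure Ω) (τ ξ : ℕ → Ω → ℝ) (i : ℕ) (u : ℝ) : ℝ≥0∞ :=
  if 0 ≤ u then μ {ω | ENNReal.ofReal u < busyPeriod τ ξ i ω} else 0

/-- The expected number of customers of the `i`-th busy period by the time since its start at which
they arrive; the customer who opens it contributes a unit mass at `0`. -/
noncomputable def arrivalMeasure (μ : Measure Ω) (τ ξ : ℕ → Ω → ℝ) (i : ℕ) : Measure ℝ :=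
  Measure.sum fun n => (μ.restrict {ω | InBusy τ ξ i n ω}).map (elapsed τ ξ i n)

lemma measure_eq_tsum_of_existsUnique {E : Set Ω} {s : ℕ → Set Ω} (hs : ∀ n, MeasurableSet (s n))
    (h : ∀ᵐ ω ∂μ, ω ∈ E ↔ ∃ n, ω ∈ s n)
    (huniq : ∀ᵐ ω ∂μ, ∀ n n', ω ∈ s n → ω ∈ s n' → n = n') : μ E = ∑' n, μ (s n) := by
  have h1 : E =ᵐ[μ] ⋃ n, s n := by
    refine eventuallyEq_set.2 (h.mono fun ω hω => ?_)
    rw [hω, mem_iUnion]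
  rw [measure_congr h1, measure_iUnion₀ ?_ fun n => (hs n).nullMeasurableSet]
  intro n n' hne
  refine measure_eq_zero_iff_ae_notMem.2 (huniq.mono fun ω hω hmem => ?_)
  exact hne (hω n n' hmem.1 hmem.2)

lemma measurableSet_prod_residualSet (hτ : ∀ n, Measurable (τ n)) (hξ : ∀ n, Measurable (ξ n))
    (i n : ℕ) : MeasurableSet {p : ℝ × Ω | p.2 ∈ residualSet τ ξ i n p.1} := by
  have h1 : MeasurableSet {ω | InBusy τ ξ i n ω} :=
    measurableSet_inBusy (fun j _ => hτ j) fun j _ => hξ j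
  have h2 : Measurable (elapsed τ ξ i n) := measurable_elapsed (fun j _ => hτ j) fun j _ => hξ j
  have h3 : Measurable (residual τ ξ n) := measurable_residual (fun j _ => hτ j) fun j _ => hξ j
  have h4 := hτ (n + 1)
  simp only [residualSet, mem_ofPred_eq]
  exact measurableSet_and (measurable_snd h1) (measurableSet_and
    (measurableSet_le (by fun_prop) (by fun_prop)) (measurableSet_and
      (measurableSet_lt (by fun_prop) (by fun_prop))
      (measurableSet_lt (by fun_prop) (by fun_prop))))

lemma measurableSet_residualSet (hτ : ∀ n, Measurable (τ n)) (hξ : ∀ n, Measurable (ξ n))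
    (i n : ℕ) (u : ℝ) : MeasurableSet (residualSet τ ξ i n u) :=
  measurable_prodMk_left (x := u) (measurableSet_prod_residualSet hτ hξ i n)

lemma measurableSet_lastSet (hτ : ∀ n, Measurable (τ n)) (hξ : ∀ n, Measurable (ξ n))
    (i n : ℕ) (u : ℝ) : MeasurableSet (lastSet τ ξ i n u) := by
  have h1 : MeasurableSet {ω | InBusy τ ξ i n ω} :=
    measurableSet_inBusy (fun j _ => hτ j) fun j _ => hξ j
  have h2 : Measurable (elapsed τ ξ i n) := measurable_elapsed (fun j _ => hτ j) fun j _ => hξ j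
  have h3 : Measurable (future τ ξ (n + 1)) := measurable_future (fun j _ => hτ j) fun j _ => hξ j
  have h4 := hξ n
  have h5 : Measurable fun ω => (u - elapsed τ ξ i n ω, future τ ξ (n + 1) ω) := by fun_prop
  exact measurableSet_and h1 (measurableSet_and (measurableSet_le (by fun_prop) (by fun_prop))
    (measurableSet_and (measurableSet_lt (by fun_prop) (by fun_prop)) (h5 measurableSet_idleAt)))

lemma lintegral_arrivalMeasure (hτ : ∀ n, Measurable (τ n)) (hξ : ∀ n, Measurable (ξ n)) (i : ℕ)
    {h : ℝ → ℝ≥0∞} (hh : Measurable h) :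
    ∫⁻ s, h s ∂arrivalMeasure μ τ ξ i =
      ∑' n, ∫⁻ ω, (if InBusy τ ξ i n ω then h (elapsed τ ξ i n ω) else 0) ∂μ := by
  rw [arrivalMeasure, lintegral_sum_measure]
  refine tsum_congr fun n => ?_
  have h1 : MeasurableSet {ω | InBusy τ ξ i n ω} :=
    measurableSet_inBusy (fun j _ => hτ j) fun j _ => hξ j
  rw [lintegral_map hh (measurable_elapsed (fun j _ => hτ j) fun j _ => hξ j),
    ← lintegral_indicator h1]
  rfl

variable [IsProbabilityMeasure μ]

lemma IsQueue.busyTail_eq_residual (hQ : IsQueue μ Λ G τ ξ) (hτ : ∀ n, Measurable (τ n))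
    (hξ : ∀ n, Measurable (ξ n)) (hex : ∀ᵐ ω ∂μ, ∃ o, OpensNth τ ξ i o ω) (u : ℝ) :
    busyTail μ τ ξ i u = ∑' n, μ (residualSet τ ξ i n u) := by
  rw [busyTail]
  split_ifs with hu
  · refine measure_eq_tsum_of_existsUnique (fun n => measurableSet_residualSet hτ hξ i n u) ?_ ?_
    · filter_upwards [hQ.ae_regular hτ hξ, hex] with ω h1 h2
      refine (ofReal_lt_busyPeriod_iff_residual h1 h2 hu).trans (exists_congr fun n => ?_)
      exact and_congr_right fun _ => and_congr_right fun _ => and_comm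
    · filter_upwards [hQ.ae_regular hτ hξ] with ω h1 n n' hn hn'
      exact eq_of_residual h1 hn.1 hn.2.1 hn.2.2.2 hn'.1 hn'.2.1 hn'.2.2.2
  · refine (ENNReal.tsum_eq_zero.2 fun n => ?_).symm
    refine measure_eq_zero_iff_ae_notMem.2 ?_
    filter_upwards [hQ.ae_regular hτ hξ] with ω h1 hω
    exact hu (h1.elapsed_nonneg.trans hω.2.1)

lemma IsQueue.busyTail_eq_last (hQ : IsQueue μ Λ G τ ξ) (hτ : ∀ n, Measurable (τ n))
    (hξ : ∀ n, Measurable (ξ n)) (hex : ∀ᵐ ω ∂μ, ∃ o, OpensNth τ ξ i o ω) (u : ℝ) :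
    busyTail μ τ ξ i u = ∑' n, μ (lastSet τ ξ i n u) := by
  rw [busyTail]
  split_ifs with hu
  · refine measure_eq_tsum_of_existsUnique (fun n => measurableSet_lastSet hτ hξ i n u) ?_ ?_
    · filter_upwards [hQ.ae_regular hτ hξ, hex] with ω h1 h2
      exact ofReal_lt_busyPeriod_iff_last h1 h2 hu
    · refine Eventually.of_forall fun ω n n' hn hn' => le_antisymm ?_ ?_
      · exact le_of_last hn'.1 hn'.2.2.2 hn.1 hn.2.1 hn.2.2.1
      · exact le_of_last hn.1 hn.2.2.2 hn'.1 hn'.2.1 hn'.2.2.1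
  · refine (ENNReal.tsum_eq_zero.2 fun n => ?_).symm
    refine measure_eq_zero_iff_ae_notMem.2 ?_
    filter_upwards [hQ.ae_regular hτ hξ] with ω h1 hω
    exact hu (h1.elapsed_nonneg.trans hω.2.1)

/-- The indices of the primitives which decide on the system up to the arrival of customer `n`. -/
def pastIndices (n : ℕ) : Set (ℕ ⊕ ℕ) := {k | Sum.elim (fun j => j ≤ n) (fun j => j < n) k}

omit [MeasurableSpace Ω] in
lemma measurable_sigmaOf_inBusy_elapsed {S : Set (ℕ ⊕ ℕ)} (hS : pastIndices n ⊆ S) :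
    Measurable[sigmaOf τ ξ S] fun ω => (InBusy τ ξ i n ω, elapsed τ ξ i n ω) := by
  have h1 : ∀ j ≤ n, Measurable[sigmaOf τ ξ S] (τ j) := fun j hj =>
    measurable_sigmaOf_interarrival (hS hj)
  have h2 : ∀ j < n, Measurable[sigmaOf τ ξ S] (ξ j) := fun j hj =>
    measurable_sigmaOf_service (hS hj)
  exact ((@measurableSet_setOfPred _ (_) _).1 (@measurableSet_inBusy _ _ _ _ _ (_) h1 h2)).prodMk
    (@measurable_elapsed _ _ _ _ _ (_) h1 h2)

/-- The past of customer `n`, the service time of this customer and the later customers are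
independent, and the later customers form a queue with the same law. -/
lemma IsQueue.measure_lastSet (hQ : IsQueue μ Λ G τ ξ) (hτ : ∀ n, Measurable (τ n))
    (hξ : ∀ n, Measurable (ξ n)) (i n : ℕ) (u : ℝ) :
    μ (lastSet τ ξ i n u) =
      ∫⁻ ω, (if InBusy τ ξ i n ω then lastDensity μ G τ ξ (u - elapsed τ ξ i n ω) else 0) ∂μ := by
  let S := pastIndices n
  let Y : Ω → Prop × ℝ := fun ω => (InBusy τ ξ i n ω, elapsed τ ξ i n ω)
  let W : Ω → ℝ × (ℕ ⊕ ℕ → ℝ) := fun ω => (ξ n ω, future τ ξ (n + 1) ω)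
  have hY : Measurable Y := (measurableSet_setOfPred.1
    (measurableSet_inBusy (fun j _ => hτ j) fun j _ => hξ j)).prodMk
    (measurable_elapsed (fun j _ => hτ j) fun j _ => hξ j)
  have hfut : Measurable (future τ ξ (n + 1)) := measurable_future (fun j _ => hτ j) fun j _ => hξ j
  have hW : Measurable W := (hξ n).prodMk hfut
  have hind1 : IndepFun Y W μ := by
    refine hQ.indepFun_of_disjoint hτ hξ S Sᶜ disjoint_compl_right
      (measurable_sigmaOf_inBusy_elapsed subset_rfl) ?_
    refine @Measurable.prodMk _ _ _ _ _ (_) _ _ (measurable_sigmaOf_service ?_)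
      (@measurable_future _ _ _ _ (_) (fun j hj => measurable_sigmaOf_interarrival ?_)
        (fun j hj => measurable_sigmaOf_service ?_)) <;> simp [S, pastIndices] <;> omega
  have hind2 : IndepFun (ξ n) (future τ ξ (n + 1)) μ := by
    refine hQ.indepFun_of_disjoint hτ hξ {Sum.inr n} {Sum.inr n}ᶜ disjoint_compl_right
      (measurable_sigmaOf_service rfl) ?_
    refine @measurable_future _ _ _ _ (_) (fun j hj => measurable_sigmaOf_interarrival ?_)
      (fun j hj => measurable_sigmaOf_service ?_)
    · simp
    · simp; omega
  let A : Set ((Prop × ℝ) × (ℝ × (ℕ ⊕ ℕ → ℝ))) :=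
    {p | p.1.1 ∧ p.1.2 ≤ u ∧ u - p.1.2 < p.2.1 ∧ IdleAt (u - p.1.2) p.2.2}
  have hA : MeasurableSet A := by
    refine measurableSet_and (measurableSet_setOfPred.2 measurable_fst.fst)
      (measurableSet_and (measurableSet_le (by fun_prop) (by fun_prop))
        (measurableSet_and (measurableSet_lt (by fun_prop) (by fun_prop)) ?_))
    exact (by fun_prop : Measurable fun p : (Prop × ℝ) × (ℝ × (ℕ ⊕ ℕ → ℝ)) => (u - p.1.2, p.2.2))
      measurableSet_idleAt
  refine (measure_setOf_of_indepFun hind1 hY hW hA).trans (lintegral_congr fun ω => ?_)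
  by_cases hB : InBusy τ ξ i n ω
  · by_cases hu : elapsed τ ξ i n ω ≤ u
    · have h := hind2.measure_inter_preimage_eq_mul (Ioi (u - elapsed τ ξ i n ω))
        {w | IdleAt (u - elapsed τ ξ i n ω) w} measurableSet_Ioi (measurableSet_idleAt_left _)
      rw [if_pos hB, lastDensity, if_pos (sub_nonneg.2 hu),
        ← hQ.measure_idleAt_future hτ hξ (n + 1), ← hQ.measure_service n measurableSet_Ioi]
      refine Eq.trans (congrArg μ ?_) h
      ext ω'
      exact ⟨fun h => h.2.2, fun h => ⟨hB, hu, h⟩⟩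
    · rw [if_pos hB, lastDensity, if_neg (by simpa using hu)]
      refine measure_mono_null (fun ω' h => ?_) measure_empty
      exact hu h.2.1
  · rw [if_neg hB]
    refine measure_mono_null (fun ω' h => ?_) measure_empty
    exact hB h.1

/-- The tail of the busy period as a convolution: the period lasts until after time `u` iff it has a
customer, arriving at some time `s ≤ u`, who is still present at time `u` while all later customers
have left. -/
lemma IsQueue.busyTail_eq_lintegral (hQ : IsQueue μ Λ G τ ξ) (hτ : ∀ n, Measurable (τ n))
    (hξ : ∀ n, Measurable (ξ n)) (hex : ∀ᵐ ω ∂μ, ∃ o, OpensNth τ ξ i o ω) (u : ℝ) :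
    busyTail μ τ ξ i u = ∫⁻ s, lastDensity μ G τ ξ (u - s) ∂arrivalMeasure μ τ ξ i := by
  rw [hQ.busyTail_eq_last hτ hξ hex, lintegral_arrivalMeasure hτ hξ i
    (h := fun s => lastDensity μ G τ ξ (u - s)) ((measurable_lastDensity hτ hξ).comp (by fun_prop))]
  exact tsum_congr fun n => hQ.measure_lastSet hτ hξ i n u

/-- The contribution of customer `n + 1` to the arrivals within a busy period, by conditioning on
what happens up to the arrival of customer `n`. -/
lemma IsQueue.lintegral_succ_eq (hQ : IsQueue μ Λ G τ ξ) (hτ : ∀ n, Measurable (τ n))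
    (hξ : ∀ n, Measurable (ξ n)) (i n : ℕ) {h : ℝ → ℝ≥0∞} (hh : Measurable h) :
    ∫⁻ ω, (if InBusy τ ξ i n ω ∧ τ (n + 1) ω < residual τ ξ n ω
        then h (elapsed τ ξ i n ω + τ (n + 1) ω) else 0) ∂μ =
      ENNReal.ofReal Λ * ∫⁻ u, h u * μ (residualSet τ ξ i n u) := by
  let Y : Ω → (Prop × ℝ) × ℝ := fun ω => ((InBusy τ ξ i n ω, elapsed τ ξ i n ω), residual τ ξ n ω)
  have hB : MeasurableSet {ω | InBusy τ ξ i n ω} :=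
    measurableSet_inBusy (fun j _ => hτ j) fun j _ => hξ j
  have hE : Measurable (elapsed τ ξ i n) := measurable_elapsed (fun j _ => hτ j) fun j _ => hξ j
  have hR : Measurable (residual τ ξ n) := measurable_residual (fun j _ => hτ j) fun j _ => hξ j
  have hY : Measurable Y := ((measurableSet_setOfPred.1 hB).prodMk hE).prodMk hR
  have hind : IndepFun Y (τ (n + 1)) μ := by
    refine hQ.indepFun_of_disjoint hτ hξ {Sum.inl (n + 1)}ᶜ {Sum.inl (n + 1)} disjoint_compl_left
      ?_ (measurable_sigmaOf_interarrival rfl)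
    refine @Measurable.prodMk _ _ _ _ _ (_) _ _ (measurable_sigmaOf_inBusy_elapsed ?_)
      (@measurable_residual _ _ _ _ (_) (fun j hj => measurable_sigmaOf_interarrival ?_)
        fun j hj => measurable_sigmaOf_service ?_)
    · rintro (j | j) hj
      · have : j ≤ n := hj
        simp; omega
      · simp
    · simp; omega
    · simp
  have hΦ : Measurable fun p : ((Prop × ℝ) × ℝ) × ℝ =>
      if p.1.1.1 ∧ p.2 < p.1.2 then h (p.1.1.2 + p.2) else 0 :=
    Measurable.ite (measurableSet_and (measurableSet_setOfPred.2 measurable_fst.fst.fst)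
      (measurableSet_lt (by fun_prop) (by fun_prop))) (hh.comp (by fun_prop)) measurable_const
  have hind2 := lintegral_comp_of_indepFun hind hY (hτ (n + 1)) hΦ
  refine hind2.trans ?_
  have hexp : Measurable fun v : ℝ => expMeasure Λ (Ioi v) := measurable_measure_Ioi
  -- integrate over the interarrival time, and count time from the start of the busy period
  have e1 : ∀ ω, ∫⁻ ω', (if InBusy τ ξ i n ω ∧ τ (n + 1) ω' < residual τ ξ n ω
      then h (elapsed τ ξ i n ω + τ (n + 1) ω') else 0) ∂μ =
      ENNReal.ofReal Λ * ∫⁻ u, h u * (if InBusy τ ξ i n ω ∧ elapsed τ ξ i n ω ≤ u ∧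
        u - elapsed τ ξ i n ω < residual τ ξ n ω
        then expMeasure Λ (Ioi (u - elapsed τ ξ i n ω)) else 0) := fun ω => by
    have hφ : Measurable fun v => if InBusy τ ξ i n ω ∧ v < residual τ ξ n ω
        then h (elapsed τ ξ i n ω + v) else 0 :=
      Measurable.ite (measurableSet_and (MeasurableSet.const _) measurableSet_Iio) (hh.comp (by fun_prop))
        measurable_const
    rw [← lintegral_map hφ (hτ (n + 1)), (hQ.hasLaw_interarrival (n + 1)).map_eq,
      lintegral_expMeasure hQ.rate_pos hφ, ← lintegral_indicator measurableSet_Ici]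
    refine congrArg _ (Eq.trans (lintegral_congr fun v => ?_) (lintegral_add_left_eq_self
      (μ := (volume : Measure ℝ)) (fun u => h u * (if InBusy τ ξ i n ω ∧ elapsed τ ξ i n ω ≤ u ∧
        u - elapsed τ ξ i n ω < residual τ ξ n ω
        then expMeasure Λ (Ioi (u - elapsed τ ξ i n ω)) else 0)) (elapsed τ ξ i n ω)))
    simp only [add_sub_cancel_left, le_add_iff_nonneg_right, indicator, mem_Ici]
    by_cases h1 : InBusy τ ξ i n ω <;> by_cases h2 : 0 ≤ v <;>
      by_cases h3 : v < residual τ ξ n ω <;> simp [h1, h2, h3]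
  have e2 : ∀ u, ∫⁻ ω, (if InBusy τ ξ i n ω ∧ elapsed τ ξ i n ω ≤ u ∧
        u - elapsed τ ξ i n ω < residual τ ξ n ω
        then expMeasure Λ (Ioi (u - elapsed τ ξ i n ω)) else 0) ∂μ =
      μ (residualSet τ ξ i n u) := fun u => by
    let A : Set (((Prop × ℝ) × ℝ) × ℝ) :=
      {p | p.1.1.1 ∧ p.1.1.2 ≤ u ∧ u - p.1.1.2 < p.1.2 ∧ u - p.1.1.2 < p.2}
    have hA : MeasurableSet A := measurableSet_and (measurableSet_setOfPred.2 measurable_fst.fst.fst)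
      (measurableSet_and (measurableSet_le (by fun_prop) (by fun_prop))
        (measurableSet_and (measurableSet_lt (by fun_prop) (by fun_prop))
          (measurableSet_lt (by fun_prop) (by fun_prop))))
    refine ((measure_setOf_of_indepFun hind hY (hτ (n + 1)) hA).trans
      (lintegral_congr fun ω => ?_)).symm
    split_ifs with hc
    · rw [← hQ.measure_interarrival (n + 1) measurableSet_Ioi]
      congr 1
      ext ω'
      exact ⟨fun h => h.2.2.2, fun h => ⟨hc.1, hc.2.1, hc.2.2, h⟩⟩
    · refine measure_mono_null (fun ω' h => ?_) measure_empty
      exact hc ⟨h.1, h.2.1, h.2.2.1⟩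
  have hjoint : Measurable fun p : Ω × ℝ => h p.2 * (if InBusy τ ξ i n p.1 ∧
      elapsed τ ξ i n p.1 ≤ p.2 ∧ p.2 - elapsed τ ξ i n p.1 < residual τ ξ n p.1
        then expMeasure Λ (Ioi (p.2 - elapsed τ ξ i n p.1)) else 0) := by
    refine (hh.comp measurable_snd).mul (Measurable.ite (measurableSet_and (measurable_fst hB)
      (measurableSet_and (measurableSet_le (by fun_prop) (by fun_prop))
        (measurableSet_lt (by fun_prop) (by fun_prop)))) (hexp.comp (by fun_prop))
      measurable_const)
  calc ∫⁻ ω, ∫⁻ ω', (if InBusy τ ξ i n ω ∧ τ (n + 1) ω' < residual τ ξ n ω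
      then h (elapsed τ ξ i n ω + τ (n + 1) ω') else 0) ∂μ ∂μ
      = ∫⁻ ω, ENNReal.ofReal Λ * (∫⁻ u, h u * (if InBusy τ ξ i n ω ∧ elapsed τ ξ i n ω ≤ u ∧
        u - elapsed τ ξ i n ω < residual τ ξ n ω
        then expMeasure Λ (Ioi (u - elapsed τ ξ i n ω)) else 0)) ∂μ := lintegral_congr e1
    _ = ENNReal.ofReal Λ * ∫⁻ u : ℝ, ∫⁻ ω, h u * (if InBusy τ ξ i n ω ∧ elapsed τ ξ i n ω ≤ u ∧
        u - elapsed τ ξ i n ω < residual τ ξ n ω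
        then expMeasure Λ (Ioi (u - elapsed τ ξ i n ω)) else 0) ∂μ := by
      rw [lintegral_const_mul' _ _ ENNReal.ofReal_ne_top, lintegral_lintegral_swap
        hjoint.aemeasurable]
    _ = ENNReal.ofReal Λ * ∫⁻ u, h u * μ (residualSet τ ξ i n u) := by
      congr 1
      refine lintegral_congr fun u => ?_
      rw [← e2 u, lintegral_const_mul]
      refine Measurable.ite (measurableSet_and hB
      (measurableSet_and (measurableSet_le (by fun_prop) (by fun_prop))
        (measurableSet_lt (by fun_prop) (by fun_prop)))) (hexp.comp (by fun_prop))
        measurable_const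

/-- As Poisson arrivals see time averages, customers arrive during the busy period at the rate `Λ`,
in addition to the one who opens it. -/
lemma IsQueue.lintegral_arrivalMeasure_eq (hQ : IsQueue μ Λ G τ ξ) (hτ : ∀ n, Measurable (τ n))
    (hξ : ∀ n, Measurable (ξ n)) (hex : ∀ᵐ ω ∂μ, ∃ o, OpensNth τ ξ i o ω)
    {h : ℝ → ℝ≥0∞} (hh : Measurable h) :
    ∫⁻ s, h s ∂arrivalMeasure μ τ ξ i =
      h 0 + ENNReal.ofReal Λ * ∫⁻ u, h u * busyTail μ τ ξ i u := by
  have hO : ∀ n, MeasurableSet {ω | OpensNth τ ξ i n ω} := fun n =>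
    measurableSet_opensNth (fun j _ => hτ j) fun j _ => hξ j
  have hopen : ∑' n, ∫⁻ ω, (if OpensNth τ ξ i n ω then h 0 else 0) ∂μ = h 0 := by
    have h1 : ∀ n, ∫⁻ ω, (if OpensNth τ ξ i n ω then h 0 else 0) ∂μ =
        h 0 * μ {ω | OpensNth τ ξ i n ω} := fun n => by
      rw [← lintegral_ite_one (hO n), ← lintegral_const_mul _
        (Measurable.ite (hO n) measurable_const measurable_const)]
      simp
    simp only [h1]
    rw [ENNReal.tsum_mul_left, ← measure_eq_tsum_of_existsUnique (E := univ) hO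
      (hex.mono fun ω hω => ⟨fun _ => hω, fun _ => trivial⟩)
      (Eventually.of_forall fun ω n n' h h' => OpensNth.unique h h'), measure_univ, mul_one]
  have hsucc : ∀ n, ∫⁻ ω, (if InBusy τ ξ i (n + 1) ω then h (elapsed τ ξ i (n + 1) ω) else 0) ∂μ =
      ∫⁻ ω, (if OpensNth τ ξ i (n + 1) ω then h 0 else 0) ∂μ +
        ENNReal.ofReal Λ * ∫⁻ u, h u * μ (residualSet τ ξ i n u) := fun n => by
    rw [← hQ.lintegral_succ_eq hτ hξ i n hh, ← lintegral_add_left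
      (Measurable.ite (hO _) measurable_const measurable_const)]
    refine lintegral_congr_ae ?_
    filter_upwards [hQ.ae_regular hτ hξ] with ω hω
    simp only [← not_opens_succ_iff hω]
    by_cases h1 : OpensNth τ ξ i (n + 1) ω
    · rw [if_pos h1.inBusy, if_pos h1, if_neg (fun h2 => h2.2 h1.1), h1.elapsed_eq_zero, add_zero]
    · rw [if_neg h1, zero_add]
      by_cases h2 : InBusy τ ξ i n ω ∧ ¬ Opens τ ξ ω (n + 1)
      · rw [if_pos (inBusy_succ_iff.2 (Or.inr h2)), if_pos h2, h2.1.elapsed_succ]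
      · rw [if_neg h2, if_neg fun h3 => (inBusy_succ_iff.1 h3).elim h1 h2]
  have hzero : ∫⁻ ω, (if InBusy τ ξ i 0 ω then h (elapsed τ ξ i 0 ω) else 0) ∂μ =
      ∫⁻ ω, (if OpensNth τ ξ i 0 ω then h 0 else 0) ∂μ :=
    lintegral_congr fun ω => if_congr inBusy_zero_iff (by simp [elapsed]) rfl
  have hmr : ∀ n, Measurable fun u => h u * μ (residualSet τ ξ i n u) := fun n =>
    hh.mul (measurable_measure_prodMk_left (measurableSet_prod_residualSet hτ hξ i n))
  have hsum : ∫⁻ u, h u * busyTail μ τ ξ i u = ∑' n, ∫⁻ u, h u * μ (residualSet τ ξ i n u) := by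
    rw [← lintegral_tsum fun n => (hmr n).aemeasurable]
    refine lintegral_congr fun u => ?_
    rw [hQ.busyTail_eq_residual hτ hξ hex, ENNReal.tsum_mul_left]
  rw [lintegral_arrivalMeasure hτ hξ i hh, tsum_eq_zero_add' ENNReal.summable, hzero]
  simp only [hsucc]
  rw [ENNReal.tsum_add, ← add_assoc, ← tsum_eq_zero_add' (f := fun n =>
    ∫⁻ ω, (if OpensNth τ ξ i n ω then h 0 else 0) ∂μ) ENNReal.summable, hopen,
    ENNReal.tsum_mul_left, hsum]

end Queue

/-! ### The tail of a busy period -/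

section Queue

variable [MeasurableSpace Ω] {μ : Measure Ω} {Λ : ℝ} {G : Measure ℝ}

/-- Moments of a busy period through its tail, provided that it is almost surely finite. -/
lemma lintegral_busyPeriod_pow_succ (hm : AEMeasurable (busyPeriod τ ξ i) μ)
    (hfin : ∀ᵐ ω ∂μ, busyPeriod τ ξ i ω ≠ ∞) (j : ℕ) :
    ∫⁻ ω, busyPeriod τ ξ i ω ^ (j + 1) ∂μ =
      (j + 1) * ∫⁻ u, ENNReal.ofReal (u ^ j) * busyTail μ τ ξ i u := by
  have h1 := lintegral_pow_succ_eq (μ := μ) (f := fun ω => (busyPeriod τ ξ i ω).toReal)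
    (Eventually.of_forall fun ω => ENNReal.toReal_nonneg) hm.ennreal_toReal j
  have h2 : ∫⁻ ω, busyPeriod τ ξ i ω ^ (j + 1) ∂μ =
      ∫⁻ ω, ENNReal.ofReal ((busyPeriod τ ξ i ω).toReal ^ (j + 1)) ∂μ := by
    refine lintegral_congr_ae (hfin.mono fun ω hω => ?_)
    simp only
    rw [ENNReal.ofReal_pow ENNReal.toReal_nonneg, ENNReal.ofReal_toReal hω]
  rw [h2, h1, restrict_Ioi_eq_restrict_Ici, ← lintegral_indicator measurableSet_Ici]
  congr 1
  refine lintegral_congr fun u => ?_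
  by_cases hu : 0 ≤ u
  · rw [indicator_of_mem (show u ∈ Ici 0 from hu), busyTail, if_pos hu, mul_comm]
    congr 1
    refine measure_congr (eventuallyEq_set.2 (hfin.mono fun ω hω => ?_))
    exact (ENNReal.ofReal_lt_iff_lt_toReal hu hω).symm
  · simp [busyTail, hu]

lemma ae_busyPeriod_ne_top (h : ∫⁻ u, busyTail μ τ ξ i u ≠ ∞) :
    ∀ᵐ ω ∂μ, busyPeriod τ ξ i ω ≠ ∞ := by
  rw [ae_iff]
  simp only [not_not]
  by_contra hne
  -- the probability of an infinite busy period bounds the tail from below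
  have h1 : ∀ u, (Ici (0 : ℝ)).indicator (fun _ => μ {ω | busyPeriod τ ξ i ω = ∞}) u ≤
      busyTail μ τ ξ i u := fun u => by
    by_cases hu : 0 ≤ u
    · rw [indicator_of_mem (show u ∈ Ici 0 from hu), busyTail, if_pos hu]
      refine measure_mono fun ω hω => ?_
      have hω' : busyPeriod τ ξ i ω = ∞ := hω
      show ENNReal.ofReal u < busyPeriod τ ξ i ω
      rw [hω']
      exact ENNReal.ofReal_lt_top
    · simp [hu]
  have h2 := lintegral_mono (μ := (volume : Measure ℝ)) h1
  rw [lintegral_indicator measurableSet_Ici, setLIntegral_const, Real.volume_Ici,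
    ENNReal.mul_top hne, top_le_iff] at h2
  exact h h2

variable [IsProbabilityMeasure μ]

instance sFinite_arrivalMeasure (i : ℕ) : SFinite (arrivalMeasure μ τ ξ i) := by
  rw [arrivalMeasure]; infer_instance

instance sFinite_lastMeasure : SFinite (lastMeasure μ Λ G τ ξ) := by
  rw [lastMeasure]; infer_instance

lemma lastMeasure_Iio_zero (hτ : ∀ n, Measurable (τ n)) (hξ : ∀ n, Measurable (ξ n)) :
    lastMeasure μ Λ G τ ξ (Iio 0) = 0 := by
  rw [← lintegral_indicator_one measurableSet_Iio,
    lintegral_lastMeasure hτ hξ (measurable_one.indicator measurableSet_Iio)]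
  convert mul_zero _
  rw [← lintegral_zero (μ := volume.restrict (Ioi (0 : ℝ)))]
  refine setLIntegral_congr_fun measurableSet_Ioi fun u hu => ?_
  have : ¬ u < 0 := not_lt.2 (le_of_lt hu)
  simp [indicator, this]

/-- The renewal equation for the arrivals within a busy period. -/
lemma IsQueue.arrivalMeasure_eq (hQ : IsQueue μ Λ G τ ξ) (hτ : ∀ n, Measurable (τ n))
    (hξ : ∀ n, Measurable (ξ n)) (hex : ∀ᵐ ω ∂μ, ∃ o, OpensNth τ ξ i o ω) :
    arrivalMeasure μ τ ξ i =
      Measure.dirac 0 + lastMeasure μ Λ G τ ξ ∗ arrivalMeasure μ τ ξ i := by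
  have hD := measurable_lastDensity (μ := μ) (G := G) hτ hξ
  refine Measure.ext_of_lintegral _ fun h hh => ?_
  rw [hQ.lintegral_arrivalMeasure_eq hτ hξ hex hh, lintegral_add_measure, lintegral_dirac' _ hh,
    Measure.conv_comm, Measure.lintegral_conv hh]
  congr 1
  have h1 : ∀ u, h u * busyTail μ τ ξ i u =
      ∫⁻ s, h u * lastDensity μ G τ ξ (u - s) ∂arrivalMeasure μ τ ξ i := fun u => by
    have hc : Measurable fun s => lastDensity μ G τ ξ (u - s) := hD.comp (by fun_prop)
    rw [hQ.busyTail_eq_lintegral hτ hξ hex, lintegral_const_mul _ hc]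
  have hjoint : Measurable fun p : ℝ × ℝ => h p.1 * lastDensity μ G τ ξ (p.1 - p.2) :=
    (hh.comp measurable_fst).mul (hD.comp (by fun_prop))
  simp only [h1]
  rw [lintegral_lintegral_swap hjoint.aemeasurable,
    ← lintegral_const_mul' _ _ ENNReal.ofReal_ne_top]
  refine lintegral_congr fun s => ?_
  have hc : Measurable fun v => h (s + v) := hh.comp (by fun_prop)
  rw [lastMeasure, lintegral_smul_measure, smul_eq_mul,
    lintegral_withDensity_eq_lintegral_mul _ hD hc]
  refine congrArg _ ((lintegral_add_left_eq_self (μ := (volume : Measure ℝ))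
    (fun u => h u * lastDensity μ G τ ξ (u - s)) s).symm.trans (lintegral_congr fun v => ?_))
  rw [add_sub_cancel_left, mul_comm]
  rfl

lemma busyTail_le_indicator (u : ℝ) : busyTail μ τ ξ i u ≤ (Ici (0 : ℝ)).indicator 1 u := by
  by_cases hu : 0 ≤ u
  · simpa [busyTail, hu] using prob_le_one
  · simp [busyTail, hu]

lemma IsQueue.arrivalMeasure_Iic_ne_top (hQ : IsQueue μ Λ G τ ξ) (hτ : ∀ n, Measurable (τ n))
    (hξ : ∀ n, Measurable (ξ n)) (hex : ∀ᵐ ω ∂μ, ∃ o, OpensNth τ ξ i o ω) (t : ℝ) :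
    arrivalMeasure μ τ ξ i (Iic t) ≠ ∞ := by
  rw [← lintegral_indicator_one measurableSet_Iic, hQ.lintegral_arrivalMeasure_eq hτ hξ hex
    (measurable_one.indicator measurableSet_Iic)]
  refine ENNReal.add_ne_top.2 ⟨?_, ENNReal.mul_ne_top ENNReal.ofReal_ne_top (ne_top_of_le_ne_top
    (b := volume (Icc 0 t)) (by simp) ?_)⟩
  · by_cases h : (0 : ℝ) ≤ t <;> simp [h]
  · rw [← lintegral_indicator_one measurableSet_Icc]
    refine lintegral_mono fun u => ?_
    refine (mul_le_mul_right (busyTail_le_indicator u) _).trans_eq ?_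
    by_cases h0 : 0 ≤ u <;> by_cases h1 : u ≤ t <;> simp [h0, h1]

/-- The tail of a busy period is a sum of convolution powers. -/
lemma IsQueue.lintegral_pow_busyTail (hQ : IsQueue μ Λ G τ ξ) (hτ : ∀ n, Measurable (τ n))
    (hξ : ∀ n, Measurable (ξ n)) (hint : Integrable (fun s : ℝ => s) G)
    (hex : ∀ᵐ ω ∂μ, ∃ o, OpensNth τ ξ i o ω) (j : ℕ) :
    ENNReal.ofReal Λ * ∫⁻ u, ENNReal.ofReal (u ^ j) * busyTail μ τ ξ i u =
      ∑' n, ∫⁻ u, ENNReal.ofReal (u ^ j) ∂convPow (lastMeasure μ Λ G τ ξ) (n + 1) := by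
  have hh : Measurable fun u : ℝ => ENNReal.ofReal (u ^ j) := by fun_prop
  have hlt : lastMeasure μ Λ G τ ξ univ < 1 := by
    rw [hQ.lastMeasure_univ hτ hξ hint, ← ENNReal.ofReal_one]
    refine (ENNReal.ofReal_lt_ofReal_iff one_pos).2 ?_
    linarith [Real.exp_pos (-(Λ * ∫ s, s ∂G))]
  have hsum := eq_sum_convPow (hQ.arrivalMeasure_eq hτ hξ hex) (lastMeasure_Iio_zero hτ hξ) hlt
    (hQ.arrivalMeasure_Iic_ne_top hτ hξ hex)
  have h1 := hQ.lintegral_arrivalMeasure_eq hτ hξ hex hh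
  rw [hsum, lintegral_sum_measure, tsum_eq_zero_add' ENNReal.summable, convPow,
    lintegral_dirac' _ hh] at h1
  exact ((ENNReal.add_right_inj ENNReal.ofReal_ne_top).1 h1).symm

lemma IsQueue.aemeasurable_busyPeriod (hQ : IsQueue μ Λ G τ ξ) (hτ : ∀ n, Measurable (τ n))
    (hξ : ∀ n, Measurable (ξ n)) (hex : ∀ᵐ ω ∂μ, ∃ o, OpensNth τ ξ i o ω) :
    AEMeasurable (busyPeriod τ ξ i) μ := by
  have key : ∀ u : ℝ, 0 ≤ u → NullMeasurableSet {ω | ENNReal.ofReal u < busyPeriod τ ξ i ω} μ := by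
    intro u hu
    refine NullMeasurableSet.congr (s := ⋃ n, lastSet τ ξ i n u)
      (MeasurableSet.iUnion fun n => measurableSet_lastSet hτ hξ i n u).nullMeasurableSet ?_
    refine eventuallyEq_set.2 ?_
    filter_upwards [hQ.ae_regular hτ hξ, hex] with ω h1 h2
    rw [mem_iUnion]
    exact (ofReal_lt_busyPeriod_iff_last h1 h2 hu).symm
  refine NullMeasurable.aemeasurable ?_
  refine measurable_of_Ioi (α := ℝ≥0∞) (δ := NullMeasurableSpace Ω μ) fun a => ?_
  rcases eq_or_ne a ∞ with rfl | ha
  · show NullMeasurableSet (busyPeriod τ ξ i ⁻¹' Ioi ∞) μ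
    simp
  · have := key a.toReal ENNReal.toReal_nonneg
    rw [ENNReal.ofReal_toReal ha] at this
    exact this

end Queue

/-! ### The power series `φ` -/

section Phi

lemma summable_succ_pow_mul_pow (j : ℕ) {x : ℝ} (hx : |x| < 1) :
    Summable fun n : ℕ => ((n : ℝ) + 1) ^ j * x ^ n := by
  rcases eq_or_ne x 0 with rfl | h0
  · refine summable_of_ne_finset_zero (s := {0}) fun n hn => ?_
    simp [zero_pow (show n ≠ 0 by simpa using hn)]
  · have h := (summable_nat_add_iff 1).2 (summable_pow_mul_geometric_of_norm_lt_one j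
      (r := x) (by simpa using hx))
    refine (h.mul_left x⁻¹).congr fun n => ?_
    push_cast
    rw [pow_succ]
    field_simp

lemma phi_eq_mul_tsum (x : ℝ) (j : ℕ) : phi x j = x * ∑' n : ℕ, ((n : ℝ) + 1) ^ j * x ^ n := by
  rw [phi, ← tsum_mul_left]
  exact tsum_congr fun n => by ring

lemma hasDerivAt_phi (j : ℕ) {x : ℝ} (hx : |x| < 1) :
    HasDerivAt (fun y => phi y j) (∑' n : ℕ, ((n : ℝ) + 1) ^ (j + 1) * x ^ n) x := by
  obtain ⟨r, hxr, hr⟩ := exists_between hx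
  have hr0 : 0 ≤ r := (abs_nonneg x).trans hxr.le
  refine hasDerivAt_tsum_of_isPreconnected (t := Metric.ball 0 r) (y₀ := 0)
    (u := fun n : ℕ => ((n : ℝ) + 1) ^ (j + 1) * r ^ n)
    (g' := fun n y => ((n : ℝ) + 1) ^ (j + 1) * y ^ n)
    (summable_succ_pow_mul_pow (j + 1) (by rwa [abs_of_nonneg hr0])) Metric.isOpen_ball
    (convex_ball _ _).isPreconnected (fun n y _ => ?_) (fun n y hy => ?_)
    (by simpa using (abs_nonneg x).trans_lt hxr) (by simp [summable_zero]) (by simpa using hxr)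
  · refine ((hasDerivAt_pow (n + 1) y).const_mul _).congr_deriv ?_
    push_cast
    ring
  · rw [norm_mul, norm_pow, norm_pow, Real.norm_of_nonneg (by positivity : (0 : ℝ) ≤ n + 1)]
    have : ‖y‖ ≤ r := by simpa using (Metric.mem_ball.1 hy).le
    gcongr

lemma phi_zero {x : ℝ} (hx : |x| < 1) : 1 / (1 - x) = phi x 0 + 1 := by
  have h1 : 1 - x ≠ 0 := by linarith [(abs_lt.1 hx).2]
  rw [phi_eq_mul_tsum]
  simp only [pow_zero, one_mul]
  rw [tsum_geometric_of_abs_lt_one hx]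
  field_simp
  ring

lemma eulerOp_eq_phi {g : ℝ → ℝ} {j : ℕ} {C : ℝ} (hg : ∀ y, |y| < 1 → g y = phi y j + C) {x : ℝ}
    (hx : |x| < 1) : eulerOp g x = phi x (j + 1) := by
  have hev : g =ᶠ[𝓝 x] fun y => phi y j + C := by
    filter_upwards [(isOpen_lt continuous_abs continuous_const).mem_nhds hx] with y hy
    exact hg y hy
  rw [eulerOp, hev.deriv_eq, ((hasDerivAt_phi j hx).add_const C).deriv, phi_eq_mul_tsum]

lemma phi_eq_eulerOp_iterate {j : ℕ} (hj : 1 ≤ j) {x : ℝ} (hx : |x| < 1) :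
    phi x j = (eulerOp^[j] (fun y => 1 / (1 - y))) x := by
  induction j, hj using Nat.le_induction generalizing x with
  | base => exact (eulerOp_eq_phi (fun y hy => phi_zero hy) hx).symm
  | succ j _ ih =>
    rw [Function.iterate_succ_apply']
    exact (eulerOp_eq_phi (C := 0) (fun y hy => by rw [add_zero, ih hy]) hx).symm

end Phi

/-! ### Moments of the busy periods -/

section Queue

variable [MeasurableSpace Ω] {μ : Measure Ω} {Λ : ℝ} {G : Measure ℝ} [IsProbabilityMeasure μ]

lemma IsQueue.lintegral_busyTail (hQ : IsQueue μ Λ G τ ξ) (hτ : ∀ n, Measurable (τ n))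
    (hξ : ∀ n, Measurable (ξ n)) (hint : Integrable (fun s : ℝ => s) G)
    (hex : ∀ᵐ ω ∂μ, ∃ o, OpensNth τ ξ i o ω) :
    ∫⁻ u, busyTail μ τ ξ i u = ENNReal.ofReal ((Real.exp (Λ * ∫ s, s ∂G) - 1) / Λ) := by
  have hΛ := hQ.rate_pos
  have hΛ' : ENNReal.ofReal Λ ≠ 0 := by simpa using hΛ
  have h := hQ.lintegral_pow_busyTail hτ hξ hint hex 0
  simp only [pow_zero, ENNReal.ofReal_one, one_mul, lintegral_one, convPow_univ,
    hQ.lastMeasure_univ hτ hξ hint] at h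
  set ρ := Λ * ∫ s, s ∂G with hρ
  have hρ0 : 0 ≤ ρ := mul_nonneg hΛ.le
    (integral_nonneg_of_ae (ae_nonneg_of_Iio_zero hQ.service_nonneg))
  have hq0 : 0 ≤ 1 - Real.exp (-ρ) := by
    linarith [Real.exp_le_one_iff.2 (neg_nonpos.2 hρ0)]
  have hgeom : ∑' n : ℕ, ENNReal.ofReal (1 - Real.exp (-ρ)) ^ (n + 1) =
      ENNReal.ofReal (Real.exp ρ - 1) := by
    simp only [pow_succ]
    rw [ENNReal.tsum_mul_right, ENNReal.tsum_geometric, ← ENNReal.ofReal_one,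
      ← ENNReal.ofReal_sub _ hq0, sub_sub_cancel, ← ENNReal.ofReal_inv_of_pos (Real.exp_pos _),
      ← ENNReal.ofReal_mul (by positivity), ← Real.exp_neg, neg_neg, mul_sub, ← Real.exp_add]
    simp
  rw [hgeom] at h
  have h2 : ENNReal.ofReal (Real.exp ρ - 1) =
      ENNReal.ofReal Λ * ENNReal.ofReal ((Real.exp ρ - 1) / Λ) := by
    rw [← ENNReal.ofReal_mul hΛ.le, mul_div_cancel₀ _ hΛ.ne']
  rw [h2] at h
  exact (ENNReal.mul_right_inj hΛ' ENNReal.ofReal_ne_top).1 h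

/-- Almost surely there are infinitely many busy periods: each of them has finite mean length. -/
lemma IsQueue.ae_exists_opensNth (hQ : IsQueue μ Λ G τ ξ) (hτ : ∀ n, Measurable (τ n))
    (hξ : ∀ n, Measurable (ξ n)) (hint : Integrable (fun s : ℝ => s) G) (i : ℕ) :
    ∀ᵐ ω ∂μ, ∃ o, OpensNth τ ξ i o ω := by
  induction i with
  | zero => exact Eventually.of_forall fun ω => ⟨0, opens_zero, Nat.count_zero _⟩
  | succ i ih =>
    have hfin := ae_busyPeriod_ne_top (μ := μ) (τ := τ) (ξ := ξ) (i := i)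
      (by rw [hQ.lintegral_busyTail hτ hξ hint ih]; exact ENNReal.ofReal_ne_top)
    filter_upwards [hQ.ae_regular hτ hξ, ih, hfin] with ω h1 h2 h3
    exact exists_opensNth_succ h1 h2 h3

lemma IsQueue.lintegral_busyPeriod_pow_le (hQ : IsQueue μ Λ G τ ξ) (hτ : ∀ n, Measurable (τ n))
    (hξ : ∀ n, Measurable (ξ n)) (hint : Integrable (fun s : ℝ => s) G)
    (hpos : 0 < Λ * ∫ s, s ∂G) (i j : ℕ) (hmoment : Integrable (fun s : ℝ => s ^ (j + 1)) G) :
    ∫⁻ ω, busyPeriod τ ξ i ω ^ (j + 1) ∂μ ≤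
      ENNReal.ofReal ((∫ s, s ^ (j + 1) ∂G) / (1 - Real.exp (-(Λ * ∫ s, s ∂G))) *
        phi (1 - Real.exp (-(Λ * ∫ s, s ∂G))) j) := by
  have hΛ := hQ.rate_pos
  have hΛ' : ENNReal.ofReal Λ ≠ 0 := by simpa using hΛ
  have hex := hQ.ae_exists_opensNth hτ hξ hint i
  have hfin := ae_busyPeriod_ne_top (μ := μ) (τ := τ) (ξ := ξ) (i := i)
    (by rw [hQ.lintegral_busyTail hτ hξ hint hex]; exact ENNReal.ofReal_ne_top)
  have hnn : ∀ᵐ s ∂G, (0 : ℝ) ≤ s ^ (j + 1) :=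
    (ae_nonneg_of_Iio_zero hQ.service_nonneg).mono fun s hs => by positivity
  have hmass := hQ.lastMeasure_univ hτ hξ hint
  set q := 1 - Real.exp (-(Λ * ∫ s, s ∂G)) with hq
  have hq0 : 0 < q := by
    have := Real.exp_lt_one_iff.2 (neg_lt_zero.2 hpos)
    linarith
  have hq1 : |q| < 1 := by
    rw [abs_of_pos hq0]
    linarith [Real.exp_pos (-(Λ * ∫ s, s ∂G))]
  have hsum := summable_succ_pow_mul_pow j hq1
  have hcast : ∀ n : ℕ, ((n : ℝ≥0∞) + 1) ^ j * ENNReal.ofReal q ^ n =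
      ENNReal.ofReal (((n : ℝ) + 1) ^ j * q ^ n) := fun n => by
    rw [ENNReal.ofReal_mul (by positivity), ENNReal.ofReal_pow (by positivity),
      ENNReal.ofReal_pow hq0.le, ENNReal.ofReal_add (by positivity) zero_le_one]
    simp
  rw [lintegral_busyPeriod_pow_succ (hQ.aemeasurable_busyPeriod hτ hξ hex) hfin j]
  refine (ENNReal.mul_le_mul_iff_right hΛ' ENNReal.ofReal_ne_top).1 ?_
  set m := ∫⁻ u, ENNReal.ofReal (u ^ j) ∂lastMeasure μ Λ G τ ξ
  calc ENNReal.ofReal Λ * ((j + 1) * ∫⁻ u, ENNReal.ofReal (u ^ j) * busyTail μ τ ξ i u)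
      = (j + 1) * ∑' n, ∫⁻ u, ENNReal.ofReal (u ^ j) ∂convPow (lastMeasure μ Λ G τ ξ) (n + 1) := by
        rw [mul_left_comm, hQ.lintegral_pow_busyTail hτ hξ hint hex]
    _ ≤ (j + 1) * ∑' n : ℕ, ((n : ℝ≥0∞) + 1) ^ j * ENNReal.ofReal q ^ n * m := by
        gcongr with n
        rw [← hmass]
        exact lintegral_pow_convPow_le (lastMeasure_Iio_zero hτ hξ) j n
    _ = ((j + 1) * m) * ENNReal.ofReal (∑' n : ℕ, ((n : ℝ) + 1) ^ j * q ^ n) := by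
        rw [ENNReal.tsum_mul_right, ENNReal.ofReal_tsum_of_nonneg (fun n => by positivity) hsum]
        simp only [hcast]
        ring
    _ ≤ (ENNReal.ofReal Λ * ENNReal.ofReal (∫ s, s ^ (j + 1) ∂G)) *
          ENNReal.ofReal (∑' n : ℕ, ((n : ℝ) + 1) ^ j * q ^ n) := by
        gcongr ?_ * _
        rw [ofReal_integral_eq_lintegral_ofReal hmoment hnn]
        exact hQ.lintegral_pow_lastMeasure_le hτ hξ j
    _ = ENNReal.ofReal Λ * ENNReal.ofReal ((∫ s, s ^ (j + 1) ∂G) / q * phi q j) := by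
        rw [mul_assoc, ← ENNReal.ofReal_mul (integral_nonneg_of_ae hnn), phi_eq_mul_tsum]
        congr 2
        field_simp

end Queue

/-! ### Almost surely equal primitives -/

section Modification

lemma busyPeriod_congr {τ' ξ' : ℕ → Ω → ℝ} (hτ : ∀ n, τ n ω = τ' n ω) (hξ : ∀ n, ξ n ω = ξ' n ω) :
    busyPeriod τ ξ i ω = busyPeriod τ' ξ' i ω := by
  have hA : ∀ n, arrival τ n ω = arrival τ' n ω := fun n =>
    Finset.sum_congr rfl fun j _ => hτ j
  have hS : InService τ ξ ω = InService τ' ξ' ω := by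
    funext m t
    rw [InService, InService, hA, hξ]
  have hO : Opens τ ξ ω = Opens τ' ξ' ω := by
    funext n
    rw [Opens, Opens, hA, hS]
  have hN : ∀ t, numCustomers τ ξ t ω = numCustomers τ' ξ' t ω := fun t => by
    rw [numCustomers, numCustomers, hS]
  simp only [busyPeriod, opener, hO, hA, hN]

variable [MeasurableSpace Ω] {μ : Measure Ω} {Λ : ℝ} {G : Measure ℝ}

/-- The primitives of a queue can be taken measurable. -/
lemma IsQueue.exists_measurable (hQ : IsQueue μ Λ G τ ξ) :
    ∃ τ' ξ' : ℕ → Ω → ℝ, IsQueue μ Λ G τ' ξ' ∧ (∀ n, Measurable (τ' n)) ∧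
      (∀ n, Measurable (ξ' n)) ∧ ∀ i, busyPeriod τ ξ i =ᵐ[μ] busyPeriod τ' ξ' i := by
  have hτ := fun n => (hQ.hasLaw_interarrival n).aemeasurable
  have hξ := fun n => (hQ.hasLaw_service n).aemeasurable
  refine ⟨fun n => (hτ n).mk, fun n => (hξ n).mk, ⟨hQ.rate_pos, hQ.service_nonneg,
    fun n => (hQ.hasLaw_interarrival n).congr (hτ n).ae_eq_mk.symm,
    fun n => (hQ.hasLaw_service n).congr (hξ n).ae_eq_mk.symm, hQ.indep.congr fun k => ?_⟩,
    fun n => (hτ n).measurable_mk, fun n => (hξ n).measurable_mk, fun i => ?_⟩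
  · cases k with
    | inl j => exact (hτ j).ae_eq_mk
    | inr j => exact (hξ j).ae_eq_mk
  · filter_upwards [ae_all_iff.2 fun n => (hτ n).ae_eq_mk, ae_all_iff.2 fun n => (hξ n).ae_eq_mk]
      with ω h1 h2
    exact busyPeriod_congr h1 h2

end Modification

end MGInfinity

theorem mainTheorem7 {Ω : Type*} [MeasurableSpace Ω] (μ : Measure Ω) [IsProbabilityMeasure μ]
    (Λ : ℝ) (G : Measure ℝ) (τ ξ : ℕ → Ω → ℝ) (hQ : MGInfinity.IsQueue μ Λ G τ ξ)
    (ρ : ℝ) (hρ : ρ = Λ * ∫ s, s ∂G) (hρ_pos : 0 < ρ)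
    (k : ℕ) (hk : 1 ≤ k) (hmoment : Integrable (fun s : ℝ => s ^ k) G) (i : ℕ) :
    AEMeasurable (MGInfinity.busyPeriod τ ξ i) μ ∧
    (∫⁻ ω, MGInfinity.busyPeriod τ ξ i ω ^ k ∂μ ≤
      ENNReal.ofReal ((∫ s, s ^ k ∂G) / (1 - Real.exp (-ρ)) *
        MGInfinity.phi (1 - Real.exp (-ρ)) (k - 1))) ∧
    (∫⁻ ω, MGInfinity.busyPeriod τ ξ i ω ∂μ = ENNReal.ofReal ((Real.exp ρ - 1) / Λ)) ∧
    (∀ j : ℕ, 1 ≤ j → ∀ x : ℝ, |x| < 1 →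
      MGInfinity.phi x j = (MGInfinity.eulerOp^[j] (fun y => 1 / (1 - y))) x) := by
  obtain ⟨τ', ξ', hQ', hτ, hξ, hae⟩ := hQ.exists_measurable
  obtain ⟨j, rfl⟩ : ∃ j, k = j + 1 := ⟨k - 1, by omega⟩
  subst hρ
  -- the integral of a function which is not integrable would be zero
  have hint : Integrable (fun s : ℝ => s) G := by
    by_contra h
    rw [integral_undef h, mul_zero] at hρ_pos
    exact lt_irrefl _ hρ_pos
  have hex := hQ'.ae_exists_opensNth hτ hξ hint i
  have hm := hQ'.aemeasurable_busyPeriod hτ hξ hex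
  have hT := hQ'.lintegral_busyTail hτ hξ hint hex
  refine ⟨hm.congr (hae i).symm, ?_, ?_, fun j hj x hx => MGInfinity.phi_eq_eulerOp_iterate hj hx⟩
  · rw [lintegral_congr_ae ((hae i).mono fun ω hω => by simp only [hω] :
      (fun ω => MGInfinity.busyPeriod τ ξ i ω ^ (j + 1)) =ᵐ[μ]
        fun ω => MGInfinity.busyPeriod τ' ξ' i ω ^ (j + 1)), Nat.add_sub_cancel]
    exact hQ'.lintegral_busyPeriod_pow_le hτ hξ hint hρ_pos i j hmoment
  · have h := MGInfinity.lintegral_busyPeriod_pow_succ hm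
      (MGInfinity.ae_busyPeriod_ne_top (by rw [hT]; exact ENNReal.ofReal_ne_top)) 0
    simp only [zero_add, pow_one, pow_zero, ENNReal.ofReal_one, one_mul, Nat.cast_zero] at h
    rw [lintegral_congr_ae (hae i), h, hT]
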